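/- Let $S$ be a smooth two-dimensional manifold with a smooth ($C^\infty$) symmetric covariant 2-tensor ("metric") which in local coordinates $(x,y)$ around a point $q$ reads $ds^2=a\,dx^2+2b\,dx\,dy+c\,dy^2$. Put $\Delta=ac-b^2$, $p=dy/dx\in\mathbb{RP}^1=\mathbb R\cup\{\infty\}$, and $M(x,y,p)=\mu_0+\mu_1p+\mu_2p^2+\mu_3p^3$, where $$\mu_0=a(a_y-2b_x)+a_xb,\qquad \mu_1=b(3a_y-2b_x)+a_xc-2ac_x,$$ $$\mu_2=b(2b_y-3c_x)+2a_yc-ac_y,\qquad \mu_3=c(2b_y-c_x)-bc_y .$$ A direction $p$ is isotropic if $a+2bp+cp^2=0$ (if $c=0$ for $p=\infty$), and $\infty$ is a simple root of $M$ if $\mu_3=0\ne\mu_2$. Let $\vec V=2\Delta(\partial_x+p\,\partial_y)+M\,\partial_p$ be the corresponding vector field (defined up to a nonvanishing factor, also at $p=\infty$) on the projectivized tangent bundle $PTS$. A (non-parametrized) geodesic passing through $q$ with direction $p$ is the germ at $q$ of a regular $C^1$ curve in $S$ through $q$, with tangent direction $p$ at $q$, whose lift to $PTS$ by its tangent directions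 is, except possibly at $q$ itself, a nonsingular integral curve of $\vec V$ up to the choice of the parameter; curves that differ by a regular change of parameter are identified. Suppose that $q$ is a degenerate point, $\Delta(q)=0$, and that $M(q,\cdot)$ has three simple real roots in $\mathbb{RP}^1$: the isotropic direction $p_0$ and two non-isotropic directions $p_1,p_2$ (case $C_3$). Suppose that the sign of the metric is chosen so that it is positive definite at the points near $q$ where $\Delta>0$. Then for each $i=1,2$ there is exactly one geodesic passing through $q$ with direction $p_i$. Both of these geodesics are smooth ($C^\infty$) and timelike, i.e. $ds^2>0$ on their tangent vectors, including at $q$. -/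

import Mathlib

open Set Filter Topology
open scoped ContDiff Manifold

/-- The plane of local coordinates; the coordinates of `z` are `x = z 0` and `y = z 1`. -/
abbrev Plane : Type := EuclideanSpace ℝ (Fin 2)

/-- The direction `p = dy/dx` of a nonzero vector `v = (dx, dy)`, a point of the projective line
`ℝ ∪ {∞}`. -/
noncomputable def direction (v : Plane) : OnePoint ℝ :=
  open Classical in if v 0 = 0 then OnePoint.infty else ((v 1 / v 0 : ℝ) : OnePoint ℝ)

/-- The coefficients of a metric `ds² = a dx² + 2 b dx dy + c dy²` in local coordinates. -/
structure MetricCoeffs where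
  a : Plane → ℝ
  b : Plane → ℝ
  c : Plane → ℝ

/-- Partial derivative with respect to `x`. -/
noncomputable def partialX (f : Plane → ℝ) (z : Plane) : ℝ :=
  fderiv ℝ f z (EuclideanSpace.single 0 1)

/-- Partial derivative with respect to `y`. -/
noncomputable def partialY (f : Plane → ℝ) (z : Plane) : ℝ :=
  fderiv ℝ f z (EuclideanSpace.single 1 1)

namespace MetricCoeffs

variable (m : MetricCoeffs)

/-- The quadratic form `a dx² + 2 b dx dy + c dy²` at the point `z`, on the vector `v = (dx, dy)`. -/
def quad (z v : Plane) : ℝ :=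
  m.a z * v 0 ^ 2 + 2 * m.b z * v 0 * v 1 + m.c z * v 1 ^ 2

/-- The discriminant `Δ = a c - b²`: positive in the Riemannian domain, negative in the Lorentzian
domain, zero at the degenerate points. -/
def disc (z : Plane) : ℝ := m.a z * m.c z - m.b z ^ 2

noncomputable def mu0 (z : Plane) : ℝ :=
  m.a z * (partialY m.a z - 2 * partialX m.b z) + partialX m.a z * m.b z

noncomputable def mu1 (z : Plane) : ℝ :=
  m.b z * (3 * partialY m.a z - 2 * partialX m.b z) + partialX m.a z * m.c z
    - 2 * m.a z * partialX m.c z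

noncomputable def mu2 (z : Plane) : ℝ :=
  m.b z * (2 * partialY m.b z - 3 * partialX m.c z) + 2 * partialY m.a z * m.c z
    - m.a z * partialY m.c z

noncomputable def mu3 (z : Plane) : ℝ :=
  m.c z * (2 * partialY m.b z - partialX m.c z) - m.b z * partialY m.c z

/-- The cubic polynomial `M(z, p) = μ₀ + μ₁ p + μ₂ p² + μ₃ p³`. -/
noncomputable def M (z : Plane) (p : ℝ) : ℝ :=
  m.mu0 z + m.mu1 z * p + m.mu2 z * p ^ 2 + m.mu3 z * p ^ 3

/-- The direction `p` is isotropic at `z`: `a + 2 b p + c p² = 0` (`c = 0` for `p = ∞`). -/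
def IsIsotropic (z : Plane) : OnePoint ℝ → Prop
  | OnePoint.infty => m.c z = 0
  | OnePoint.some p => m.a z + 2 * m.b z * p + m.c z * p ^ 2 = 0

/-- The direction `p` is a simple root of the cubic `M(z, ·)` on the projective line. -/
def IsSimpleRoot (z : Plane) : OnePoint ℝ → Prop
  | OnePoint.infty => m.mu3 z = 0 ∧ m.mu2 z ≠ 0
  | OnePoint.some p => m.M z p = 0 ∧ m.mu1 z + 2 * m.mu2 z * p + 3 * m.mu3 z * p ^ 2 ≠ 0

/-- `z` is a degenerate point at which `M` has three simple real roots: the isotropic direction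
`p₀` and two non-isotropic directions `p₁`, `p₂`. -/
structure CaseC3 (z : Plane) (p₀ p₁ p₂ : OnePoint ℝ) : Prop where
  degenerate : m.disc z = 0
  ne01 : p₀ ≠ p₁
  ne02 : p₀ ≠ p₂
  ne12 : p₁ ≠ p₂
  root0 : m.IsSimpleRoot z p₀
  root1 : m.IsSimpleRoot z p₁
  root2 : m.IsSimpleRoot z p₂
  isotropic0 : m.IsIsotropic z p₀
  nonisotropic1 : ¬ m.IsIsotropic z p₁
  nonisotropic2 : ¬ m.IsIsotropic z p₂

/-- The vector field `V = 2 Δ (∂_x + p ∂_y) + M ∂_p` on the projectivized tangent bundle, in the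
affine coordinate `p = dy/dx`. -/
noncomputable def field (ξ : Plane × ℝ) : Plane × ℝ :=
  ((2 * m.disc ξ.1) • !₂[(1 : ℝ), ξ.2], m.M ξ.1 ξ.2)

/-- The same direction field in the affine coordinate `r = dx/dy = 1/p`, which covers `p = ∞`:
this is `r V = 2 Δ (r ∂_x + ∂_y) - (μ₃ + μ₂ r + μ₁ r² + μ₀ r³) ∂_r`, the field `V` of the metric
after the coordinates `x` and `y` are interchanged. -/
noncomputable def fieldInfty (ξ : Plane × ℝ) : Plane × ℝ :=
  ((2 * m.disc ξ.1) • !₂[ξ.2, (1 : ℝ)],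
    -(m.mu3 ξ.1 + m.mu2 ξ.1 * ξ.2 + m.mu1 ξ.1 * ξ.2 ^ 2 + m.mu0 ξ.1 * ξ.2 ^ 3))

/-- At the parameter `t`, the lift `(z, [z'])` of a regular plane curve `z` to the projectivized
tangent bundle is differentiable and has velocity proportional to the field `V`. (As `z' ≠ 0`,
the field is then nonzero at that point.) -/
def LiftTangentAt (z : ℝ → Plane) (t : ℝ) : Prop :=
  (deriv z t 0 ≠ 0 →
    ∃ k : ℝ, HasDerivAt (fun s => (z s, deriv z s 1 / deriv z s 0))
      (k • m.field (z t, deriv z t 1 / deriv z t 0)) t) ∧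
  (deriv z t 0 = 0 →
    ∃ k : ℝ, HasDerivAt (fun s => (z s, deriv z s 0 / deriv z s 1))
      (k • m.fieldInfty (z t, deriv z t 0 / deriv z t 1)) t)

end MetricCoeffs

/-- A smooth metric on a surface `S`, of arbitrary, possibly varying, signature: a field of
symmetric bilinear forms on the tangent spaces whose coefficients are smooth in every chart. -/
structure SurfaceMetric (S : Type*) [TopologicalSpace S] [ChartedSpace Plane S]
    [IsManifold 𝓘(ℝ, Plane) ∞ S] where
  form : (x : S) → LinearMap.BilinForm ℝ (TangentSpace 𝓘(ℝ, Plane) x)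
  symm : ∀ (x : S) (u v : TangentSpace 𝓘(ℝ, Plane) x), form x u v = form x v u
  smooth : ∀ φ ∈ IsManifold.maximalAtlas 𝓘(ℝ, Plane) ∞ S, ∀ u v : Plane,
    ContDiffOn ℝ ∞ (fun z : Plane => form (φ.symm z)
      (mfderiv 𝓘(ℝ, Plane) 𝓘(ℝ, Plane) φ.symm z u)
      (mfderiv 𝓘(ℝ, Plane) 𝓘(ℝ, Plane) φ.symm z v)) φ.target

namespace SurfaceMetric

variable {S : Type*} [TopologicalSpace S] [ChartedSpace Plane S] [IsManifold 𝓘(ℝ, Plane) ∞ S]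

/-- The value of the metric at the point with coordinates `z` in the chart `φ`, on the tangent
vectors with coordinates `u` and `v`. -/
noncomputable def inChart (g : SurfaceMetric S) (φ : OpenPartialHomeomorph S Plane)
    (u v z : Plane) : ℝ :=
  g.form (φ.symm z) (mfderiv 𝓘(ℝ, Plane) 𝓘(ℝ, Plane) φ.symm z u)
    (mfderiv 𝓘(ℝ, Plane) 𝓘(ℝ, Plane) φ.symm z v)

/-- The coefficients of the metric in the chart `φ`. -/
noncomputable def coeffs (g : SurfaceMetric S) (φ : OpenPartialHomeomorph S Plane) :
    MetricCoeffs where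
  a := g.inChart φ (EuclideanSpace.single 0 1) (EuclideanSpace.single 0 1)
  b := g.inChart φ (EuclideanSpace.single 0 1) (EuclideanSpace.single 1 1)
  c := g.inChart φ (EuclideanSpace.single 1 1) (EuclideanSpace.single 1 1)

/-- `γ`, on the interval `(-ε, ε)`, is a (regular `C¹` parametrization of a) geodesic passing
through the point `q = γ 0` with direction `p`: except possibly at `q` itself, where the field `V`
may be singular, its lift to the projectivized tangent bundle is an integral curve of `V`, up to
the choice of the parameter. Everything is expressed in the chart `φ` around `q`. -/
structure IsGeodesicThrough (g : SurfaceMetric S) (φ : OpenPartialHomeomorph S Plane) (q : S)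
    (p : OnePoint ℝ) (ε : ℝ) (γ : ℝ → S) : Prop where
  pos : 0 < ε
  mem_source : ∀ t ∈ Ioo (-ε) ε, γ t ∈ φ.source
  contDiffOn : ContDiffOn ℝ 1 (φ ∘ γ) (Ioo (-ε) ε)
  regular : ∀ t ∈ Ioo (-ε) ε, deriv (φ ∘ γ) t ≠ 0
  map_zero : γ 0 = q
  direction_zero : direction (deriv (φ ∘ γ) 0) = p
  integral : ∀ t ∈ Ioo (-ε) ε, t ≠ 0 → (g.coeffs φ).LiftTangentAt (φ ∘ γ) t

/-- The curve `γ`, on `(-ε, ε)`, is timelike: `ds² > 0` on its tangent vectors. -/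
def IsTimelike (g : SurfaceMetric S) (φ : OpenPartialHomeomorph S Plane) (ε : ℝ)
    (γ : ℝ → S) : Prop :=
  ∀ t ∈ Ioo (-ε) ε, 0 < (g.coeffs φ).quad (φ (γ t)) (deriv (φ ∘ γ) t)

end SurfaceMetric

/-- Near the parameter `0`, the curve `γ'` on `(-ε', ε')` is a regular reparametrization of the
curve `γ` on `(-ε, ε)`: the two define the same germ of non-parametrized curve at `γ 0`. -/
def IsLocalReparametrization {S : Type*} (ε : ℝ) (γ : ℝ → S) (ε' : ℝ) (γ' : ℝ → S) : Prop :=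
  ∃ δ : ℝ, 0 < δ ∧ δ ≤ ε' ∧ ∃ θ : ℝ → ℝ, θ 0 = 0 ∧ ContDiffOn ℝ 1 θ (Ioo (-δ) δ) ∧
    ∀ t ∈ Ioo (-δ) δ, deriv θ t ≠ 0 ∧ θ t ∈ Ioo (-ε) ε ∧ γ' t = γ (θ t)

/-! Take a non-isotropic simple root `P` of the cubic and put `d = dΔ(1, P)` at the degenerate
point. The lifted field vanishes at `(q, P)`; its linear part has the eigenvalues `2d`, the fibre
derivative `M_p`, and `0`. An algebraic identity (`saddle_trace`, `saddle_trace_infty`) gives `M_p =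
-2d`, and simplicity of the root gives `d ≠ 0`: a resonant saddle. Smoothness and uniqueness of the
transversal solution are obtained without normal forms.

Curves with slope near `P` are graphs solving `2Δ y'' = N(x, y, y')`. With `h = y'` and `η` the mean
of `h` over `[0, x]`, one has `y = xη`, and `Δ(x, xη) = x D(x, η)` with `D(0, P) = d` by
`exists_contDiff_blowup`. The equation becomes `(x(h - P))' = R(x, η, h)`, `R = N/(2D) + (h - P)`,
and the trace relation says precisely that `R` has no linear part in `(η, h)` at `(0, P, P)`.
Integrating, `h - P` is the mean of `R` over `[0, x]`. On the segment from `0` to `x`, rescaled to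
`[0, 1]`, this is an equation in `C([0, 1])` depending smoothly on `x`, whose linearization at `x =
0` is the identity. The implicit function theorem therefore gives one continuous germ, and it is
smooth (`exists_contDiff_averaged_solution`, `exists_contDiff_solution_of_saddle`).

Along the solution `Δ` has the sign of `x d`, so it is positive on one side of `q`. There the metric
is positive definite; in the limit `ds² ≥ 0` at `q`, and non-isotropy makes it strict, hence strict
nearby as well. The direction `∞` is treated in the same way with `x` and `y` interchanged. -/

/-! ### Smoothness of composition operators on `C(K, E)`. -/

/-- Pointwise evaluation of a continuous family of continuous linear maps, as a continuous linear
map between spaces of continuous maps. -/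
noncomputable def ContinuousMap.applyCLM (K E F : Type) [TopologicalSpace K] [CompactSpace K]
    [NormedAddCommGroup E] [NormedSpace ℝ E] [NormedAddCommGroup F] [NormedSpace ℝ F] :
    C(K, E →L[ℝ] F) →L[ℝ] C(K, E) →L[ℝ] C(K, F) :=
  LinearMap.mkContinuous₂
    (LinearMap.mk₂ ℝ (fun (A : C(K, E →L[ℝ] F)) (u : C(K, E)) =>
        (⟨fun s => A s (u s), by fun_prop⟩ : C(K, F)))
      (fun _ _ _ => by ext; simp) (fun _ _ _ => by ext; simp)
      (fun _ _ _ => by ext; simp) (fun _ _ _ => by ext; simp))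
    1 (fun A u => by
      rw [one_mul, ContinuousMap.norm_le _ (by positivity)]
      intro s
      exact ((A s).le_opNorm (u s)).trans
        (mul_le_mul (A.norm_coe_le_norm s) (u.norm_coe_le_norm s) (norm_nonneg _) (norm_nonneg A)))

theorem ContinuousMap.applyCLM_apply {K E F : Type} [TopologicalSpace K] [CompactSpace K]
    [NormedAddCommGroup E] [NormedSpace ℝ E] [NormedAddCommGroup F] [NormedSpace ℝ F]
    (A : C(K, E →L[ℝ] F)) (u : C(K, E)) (s : K) :
    ContinuousMap.applyCLM K E F A u s = A s (u s) := rfl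

/-- The derivative of the composition operator `u ↦ f ∘ u`. -/
theorem ContinuousMap.hasFDerivAt_comp {K E F : Type} [TopologicalSpace K] [CompactSpace K]
    [NormedAddCommGroup E] [NormedSpace ℝ E] [NormedAddCommGroup F] [NormedSpace ℝ F]
    (f : C(E, F)) (f' : C(E, E →L[ℝ] F)) (hf : ∀ x, HasFDerivAt f (f' x) x) (u : C(K, E)) :
    HasFDerivAt (fun u : C(K, E) => f.comp u) (applyCLM K E F (f'.comp u)) u := by
  rw [hasFDerivAt_iff_isLittleO_nhds_zero, Asymptotics.isLittleO_iff]
  intro ε hε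
  have hc : Continuous (fun v : C(K, E) => f'.comp v) := f'.continuous_postcomp
  obtain ⟨δ, hδ, H⟩ := (Metric.continuousAt_iff (f := fun v : C(K, E) => f'.comp v)
    (a := u)).1 hc.continuousAt ε hε
  filter_upwards [Metric.ball_mem_nhds (0 : C(K, E)) hδ] with h hh
  rw [mem_ball_zero_iff] at hh
  rw [ContinuousMap.norm_le _ (by positivity)]
  intro s
  -- Sup-norm continuity of `v ↦ f' ∘ v`, tested on `u` shifted by the constant `y - u s`, yields an
  -- estimate whose `δ` does not depend on `s`.
  have key : ∀ y ∈ Metric.ball (u s) δ, ‖f' y - f' (u s)‖ ≤ ε := by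
    intro y hy
    have h1 : dist (u + ContinuousMap.const K (y - u s)) u < δ := by
      rw [dist_eq_norm, add_sub_cancel_left]
      refine lt_of_le_of_lt ((ContinuousMap.norm_le _ (norm_nonneg (y - u s))).2 fun _ => le_rfl) ?_
      rwa [← dist_eq_norm]
    have h2 := H h1
    have h3 := ContinuousMap.dist_apply_le_dist (f := f'.comp (u + ContinuousMap.const K (y - u s)))
      (g := f'.comp u) s
    simp only [ContinuousMap.comp_apply, ContinuousMap.add_apply,
      ContinuousMap.const_apply, add_sub_cancel, dist_eq_norm (f' y)] at h3
    exact h3.trans h2.le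
  have hs : ‖h s‖ < δ := (h.norm_coe_le_norm s).trans_lt hh
  have := (convex_ball (u s) δ).norm_image_sub_le_of_norm_hasFDerivWithin_le' (f := f)
    (f' := fun y => f' y) (φ := f' (u s)) (fun y _ => (hf y).hasFDerivWithinAt) key
    (Metric.mem_ball_self hδ) (y := u s + h s) (by simpa [dist_eq_norm] using hs)
  simp only [add_sub_cancel_left] at this
  refine le_trans (le_of_eq ?_) (this.trans
    (mul_le_mul_of_nonneg_left (h.norm_coe_le_norm s) hε.le))
  rfl

/-- The composition operator `u ↦ f ∘ u` on continuous maps from a compact space is as smooth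
as `f`. -/
theorem ContinuousMap.contDiff_comp_nat {K E : Type} [TopologicalSpace K] [CompactSpace K]
    [NormedAddCommGroup E] [NormedSpace ℝ E] (n : ℕ) :
    ∀ {F : Type} [NormedAddCommGroup F] [NormedSpace ℝ F] (f : C(E, F)),
      ContDiff ℝ n f → ContDiff ℝ n (fun u : C(K, E) => f.comp u) := by
  -- The codomain `F` is quantified after `n`, since the inductive step uses the hypothesis for
  -- `f'`, with values in `E →L[ℝ] F`.
  induction n with
  | zero =>
    intro F _ _ f _
    exact contDiff_zero.2 f.continuous_postcomp
  | succ n ih =>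
    intro F _ _ f hf
    obtain ⟨f', hf', hd⟩ := contDiff_succ_iff_hasFDerivAt.1 (by exact_mod_cast hf)
    have := contDiff_succ_iff_hasFDerivAt.2
      ⟨fun u : C(K, E) => applyCLM K E F ((⟨f', hf'.continuous⟩ : C(E, E →L[ℝ] F)).comp u),
        (applyCLM K E F).contDiff.comp (ih ⟨f', hf'.continuous⟩ hf'),
        fun u => hasFDerivAt_comp f ⟨f', hf'.continuous⟩ hd u⟩
    exact_mod_cast this

theorem ContinuousMap.contDiff_comp {K E F : Type} [TopologicalSpace K] [CompactSpace K]
    [NormedAddCommGroup E] [NormedSpace ℝ E] [NormedAddCommGroup F] [NormedSpace ℝ F]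
    (f : C(E, F)) (hf : ContDiff ℝ ∞ f) : ContDiff ℝ ∞ (fun u : C(K, E) => f.comp u) :=
  contDiff_infty.2 fun n => contDiff_comp_nat n f (contDiff_infty.1 hf n)

/-! ### Globalizing smooth germs; the smooth implicit function theorem. -/

/-- A function that is smooth near a point agrees near that point with a globally smooth one. -/
theorem exists_contDiff_eventuallyEq {E : Type} [NormedAddCommGroup E] [NormedSpace ℝ E]
    [FiniteDimensional ℝ E] {f : E → ℝ} {z : E} (hf : ∀ᶠ x in 𝓝 z, ContDiffAt ℝ ∞ f x) :
    ∃ g : E → ℝ, ContDiff ℝ ∞ g ∧ g =ᶠ[𝓝 z] f := by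
  obtain ⟨r, hr, H⟩ := Metric.eventually_nhds_iff_ball.1 hf
  let χ : ContDiffBump z := ⟨r / 3, r / 2, by positivity, by linarith⟩
  refine ⟨fun x => χ x * f x, contDiff_iff_contDiffAt.2 fun x => ?_, ?_⟩
  · by_cases hx : x ∈ Metric.ball z r
    · exact χ.contDiff.contDiffAt.mul (H x hx)
    · have hx' : x ∉ tsupport χ := by
        rw [χ.tsupport_eq, Metric.mem_closedBall]
        rw [Metric.mem_ball] at hx
        have : χ.rOut = r / 2 := rfl
        rw [this]
        intro h
        linarith
      have h0 : (fun x => χ x * f x) =ᶠ[𝓝 x] fun _ => 0 := by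
        filter_upwards [notMem_tsupport_iff_eventuallyEq.1 hx'] with y hy
        simp [hy]
      exact contDiffAt_const.congr_of_eventuallyEq h0
  · filter_upwards [χ.eventuallyEq_one] with x hx
    simp [hx]

/-- The implicit function of a smooth equation is smooth in a neighbourhood of the base point. -/
theorem exists_implicitFunction_contDiffAt {E₁ E₂ F : Type*}
    [NormedAddCommGroup E₁] [NormedSpace ℝ E₁] [CompleteSpace E₁]
    [NormedAddCommGroup E₂] [NormedSpace ℝ E₂] [CompleteSpace E₂]
    [NormedAddCommGroup F] [NormedSpace ℝ F] [CompleteSpace F]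
    {f : E₁ × E₂ → F} (hf : ContDiff ℝ ∞ f) {u : E₁ × E₂} (hu : f u = 0)
    (hinv : (fderiv ℝ f u ∘L .inr ℝ E₁ E₂).IsInvertible) :
    ∃ U : E₁ → E₂, U u.1 = u.2 ∧ (∀ᶠ x in 𝓝 u.1, ContDiffAt ℝ ∞ U x) ∧
      ∀ᶠ v in 𝓝 u, f v = 0 ↔ U v.1 = v.2 := by
  have hn : (∞ : WithTop ℕ∞) ≠ 0 := by simp
  have hfu := hf.contDiffAt (x := u)
  set U := hfu.implicitFunction hn hinv with hU
  have hUu : U u.1 = u.2 := hfu.implicitFunction_apply_self hn hinv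
  have hiff : ∀ᶠ v in 𝓝 u, f v = 0 ↔ U v.1 = v.2 := by
    simpa [hu] using hfu.eventually_apply_eq_iff_implicitFunction hn hinv
  have hUc : ContinuousAt U u.1 := (hfu.contDiffAt_implicitFunction hn hinv).continuousAt
  have hgraph : Tendsto (fun x => (x, U x)) (𝓝 u.1) (𝓝 u) := by
    have := (continuousAt_id (x := u.1)).prodMk hUc
    simpa [ContinuousAt, hUu] using this
  have hopen : ∀ᶠ v in 𝓝 u, (fderiv ℝ f v ∘L .inr ℝ E₁ E₂).IsInvertible := by
    have hc : Continuous fun v => fderiv ℝ f v ∘L ContinuousLinearMap.inr ℝ E₁ E₂ :=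
      (hf.continuous_fderiv (by simp)).clm_comp continuous_const
    obtain ⟨e, he⟩ := hinv
    have := (hc.continuousAt (x := u)).eventually (he ▸ ContinuousLinearEquiv.nhds e)
    exact this
  refine ⟨U, hUu, ?_, hiff⟩
  -- `ContDiffAt ℝ ∞` at one point supplies, for each finite order, a neighbourhood that may shrink
  -- with the order. So the theorem is applied afresh at every nearby point of the graph, and local
  -- uniqueness identifies the new implicit function with `U`.
  filter_upwards [hgraph.eventually hiff.eventually_nhds, hgraph.eventually hopen] with x hx hinvx
  have hfx := hf.contDiffAt (x := (x, U x))
  have h0 : f (x, U x) = 0 := hx.self_of_nhds.2 rfl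
  have h1 := hfx.contDiffAt_implicitFunction hn hinvx
  refine h1.congr_of_eventuallyEq ?_
  have hg : Tendsto (fun y => (y, hfx.implicitFunction hn hinvx y)) (𝓝 x) (𝓝 (x, U x)) := by
    have h2 := (continuousAt_id (x := x)).prodMk h1.continuousAt
    have h3 := hfx.implicitFunction_apply_self hn hinvx
    simp only [ContinuousAt, id] at h2
    simp only at h3
    rwa [h3] at h2
  filter_upwards [hg.eventually hx, hfx.eventually_apply_implicitFunction hn hinvx] with y hy hy'
  exact hy.1 (hy'.trans h0)

/-! ### The averaged equation in `C([0, 1])`. -/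

/-- The average of `u` over `[0, s]`, as a bounded operator on `C([0, 1], ℝ)`. -/
noncomputable def averageCLM : C(unitInterval, ℝ) →L[ℝ] C(unitInterval, ℝ) :=
  LinearMap.mkContinuous
    { toFun := fun u => (⟨fun s => ∫ σ : unitInterval, u (σ * s), by
        have := continuous_parametric_integral_of_continuous
          (μ := (MeasureTheory.volume : MeasureTheory.Measure unitInterval))
          (f := fun s σ : unitInterval => u (σ * s)) (by fun_prop) isCompact_univ
        simpa using this⟩ : C(unitInterval, ℝ))
      map_add' := fun u v => by
        ext s
        exact MeasureTheory.integral_add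
          ((by fun_prop : Continuous fun σ => u (σ * s)).integrable_of_hasCompactSupport
            (HasCompactSupport.of_compactSpace _))
          ((by fun_prop : Continuous fun σ => v (σ * s)).integrable_of_hasCompactSupport
            (HasCompactSupport.of_compactSpace _))
      map_smul' := fun c u => by
        ext s
        exact MeasureTheory.integral_const_mul c _ }
    1 (fun u => by
      rw [one_mul, ContinuousMap.norm_le _ (norm_nonneg _)]
      intro s
      refine (MeasureTheory.norm_integral_le_of_norm_le_const (C := ‖u‖)
        (Eventually.of_forall fun σ => u.norm_coe_le_norm (σ * s))).trans ?_
      simp)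

theorem averageCLM_apply (u : C(unitInterval, ℝ)) (s : unitInterval) :
    averageCLM u s = ∫ σ : unitInterval, u (σ * s) := rfl

/-- The map sending `(x, u)` to the curve `s ↦ (s x, average of u over [0, s], u s)`. -/
noncomputable def averageGraphCLM : ℝ × C(unitInterval, ℝ) →L[ℝ] C(unitInterval, ℝ × ℝ × ℝ) :=
  LinearMap.mkContinuous
    { toFun := fun v => (⟨fun s => ((s : ℝ) * v.1, averageCLM v.2 s, v.2 s), by fun_prop⟩ :
        C(unitInterval, ℝ × ℝ × ℝ))
      map_add' := fun u v => by ext s <;> simp [mul_add]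
      map_smul' := fun c u => by ext s <;> simp [mul_left_comm] }
    (max 1 ‖averageCLM‖) (fun v => by
      rw [ContinuousMap.norm_le _ (by positivity)]
      intro s
      have h1 : ‖v.1‖ ≤ ‖v‖ := norm_fst_le v
      have h2 : ‖v.2‖ ≤ ‖v‖ := norm_snd_le v
      have h3 : ‖v‖ ≤ max 1 ‖averageCLM‖ * ‖v‖ :=
        le_mul_of_one_le_left (norm_nonneg v) (le_max_left _ _)
      refine norm_prod_le_iff.2 ⟨?_, norm_prod_le_iff.2 ⟨?_, ?_⟩⟩
      · refine le_trans ?_ (h1.trans h3)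
        change ‖(s : ℝ) * v.1‖ ≤ ‖v.1‖
        rw [norm_mul, Real.norm_of_nonneg s.2.1]
        exact mul_le_of_le_one_left (norm_nonneg v.1) s.2.2
      · exact ((averageCLM v.2).norm_coe_le_norm s).trans ((averageCLM.le_opNorm v.2).trans
          (mul_le_mul (le_max_right _ _) h2 (norm_nonneg v.2) (by positivity)))
      · exact (v.2.norm_coe_le_norm s).trans (h2.trans h3))

theorem averageGraphCLM_apply (v : ℝ × C(unitInterval, ℝ)) (s : unitInterval) :
    averageGraphCLM v s = ((s : ℝ) * v.1, averageCLM v.2 s, v.2 s) := rfl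

/-- The restriction of a function to the segment from `0` to `x`, parametrized by `[0, 1]`. -/
def segmentMap (h : C(ℝ, ℝ)) (x : ℝ) : C(unitInterval, ℝ) := ⟨fun s => h (s * x), by fun_prop⟩

theorem continuous_segmentMap (h : C(ℝ, ℝ)) : Continuous (segmentMap h) :=
  ContinuousMap.continuous_of_continuous_uncurry _ (by
    change Continuous fun z : ℝ × unitInterval => h (z.2 * z.1)
    fun_prop)

/-- The functional whose zeros `(x, u)` solve the averaged equation on the segment from `0`
to `x`. -/
noncomputable def averagedEquation (R : C(ℝ × ℝ × ℝ, ℝ)) (P : ℝ) (v : ℝ × C(unitInterval, ℝ)) :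
    C(unitInterval, ℝ) :=
  v.2 - ContinuousMap.const _ P - averageCLM (R.comp (averageGraphCLM v))

theorem averagedEquation_apply (R : C(ℝ × ℝ × ℝ, ℝ)) (P : ℝ) (x : ℝ) (u : C(unitInterval, ℝ))
    (s : unitInterval) :
    averagedEquation R P (x, u) s =
      u s - P - ∫ σ : unitInterval, R (((σ * s : unitInterval) : ℝ) * x,
        ∫ τ : unitInterval, u (τ * (σ * s)), u (σ * s)) := rfl

/-- The equation at parameter `s` involves the unknown on `[0, s]` only, so restricting a solution
to an initial subsegment and rescaling gives a solution again. -/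
theorem averagedEquation_dilate {R : C(ℝ × ℝ × ℝ, ℝ)} {P x : ℝ} {u : C(unitInterval, ℝ)}
    (h : averagedEquation R P (x, u) = 0) (t : unitInterval) :
    averagedEquation R P (t * x, u.comp ⟨fun s => s * t, by fun_prop⟩) = 0 := by
  ext s
  have := DFunLike.congr_fun h (s * t)
  rw [averagedEquation_apply] at this ⊢
  rw [ContinuousMap.zero_apply] at this ⊢
  rw [← this]
  simp only [ContinuousMap.comp_apply, ContinuousMap.coe_mk, Set.Icc.coe_mul, mul_assoc]

theorem averagedEquation_segmentMap {R : C(ℝ × ℝ × ℝ, ℝ)} {P : ℝ} {h : C(ℝ, ℝ)} {x : ℝ}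
    (s : unitInterval) :
    averagedEquation R P (x, segmentMap h x) s = h (s * x) - P -
      ∫ σ : unitInterval, R (σ * (s * x), ∫ τ : unitInterval, h (τ * (σ * (s * x))),
        h (σ * (s * x))) := by
  rw [averagedEquation_apply]
  simp only [segmentMap, ContinuousMap.coe_mk, Set.Icc.coe_mul, mul_assoc]

theorem contDiff_averagedEquation {R : C(ℝ × ℝ × ℝ, ℝ)} (hR : ContDiff ℝ ∞ R) (P : ℝ) :
    ContDiff ℝ ∞ (averagedEquation R P) :=
  (contDiff_snd.sub contDiff_const).sub
    (averageCLM.contDiff.comp ((R.contDiff_comp hR).comp averageGraphCLM.contDiff))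

/-- At `x = 0` and constant `u = P` the curve fed to `R` is constantly `(0, P, P)`, and a variation
of `u` moves it only in directions `(0, v)`, which the derivative of `R` kills. The nonlinear term
thus contributes nothing. -/
theorem fderiv_averagedEquation {R : C(ℝ × ℝ × ℝ, ℝ)} (hR : ContDiff ℝ ∞ R) {P : ℝ}
    (h1 : ∀ v : ℝ × ℝ, fderiv ℝ R (0, P, P) (0, v) = 0) :
    fderiv ℝ (averagedEquation R P) (0, ContinuousMap.const _ P) ∘L
      ContinuousLinearMap.inr ℝ ℝ C(unitInterval, ℝ) = ContinuousLinearMap.id ℝ _ := by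
  have hd := ContinuousMap.hasFDerivAt_comp (K := unitInterval) R
    ⟨fderiv ℝ R, hR.continuous_fderiv (by simp)⟩
    (fun x => (hR.differentiable (by simp) x).hasFDerivAt)
    (averageGraphCLM (0, ContinuousMap.const _ P))
  have hd2 := ((hasFDerivAt_snd (𝕜 := ℝ) (p := ((0 : ℝ), ContinuousMap.const unitInterval P))).sub_const
    (ContinuousMap.const _ P)).sub
    (averageCLM.hasFDerivAt.comp _ (hd.comp _ averageGraphCLM.hasFDerivAt))
  have hd3 : HasFDerivAt (averagedEquation R P) _ (0, ContinuousMap.const unitInterval P) := hd2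
  rw [hd3.fderiv]
  ext w s
  have hz : ∀ s, averageGraphCLM ((0 : ℝ), ContinuousMap.const _ P) s = (0, P, P) := by
    intro s
    simp [averageGraphCLM_apply, averageCLM_apply]
  have hzero : ContinuousMap.applyCLM _ _ _
      (ContinuousMap.comp ⟨fderiv ℝ R, hR.continuous_fderiv (by simp)⟩
        (averageGraphCLM (0, ContinuousMap.const _ P))) (averageGraphCLM (0, w)) = 0 := by
    ext s
    rw [ContinuousMap.applyCLM_apply, ContinuousMap.comp_apply, hz]
    simp [averageGraphCLM_apply, h1]
  simp [hzero]

/-- A smooth averaged equation whose right-hand side vanishes to second order in the unknown at the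
base point has exactly one continuous germ of solution, and this germ is smooth. -/
theorem exists_contDiff_averaged_solution {R : ℝ × ℝ × ℝ → ℝ} (hR : ContDiff ℝ ∞ R) {P : ℝ}
    (h0 : R (0, P, P) = 0) (h1 : ∀ v : ℝ × ℝ, fderiv ℝ R (0, P, P) (0, v) = 0) :
    ∃ g : ℝ → ℝ, ContDiff ℝ ∞ g ∧ g 0 = P ∧
      (∀ᶠ x in 𝓝 0, g x = P + ∫ σ : unitInterval, R (σ * x,
        ∫ τ : unitInterval, g (τ * (σ * x)), g (σ * x))) ∧
      ∀ h : ℝ → ℝ, Continuous h → h 0 = P →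
        (∀ᶠ x in 𝓝 0, h x = P + ∫ σ : unitInterval, R (σ * x,
          ∫ τ : unitInterval, h (τ * (σ * x)), h (σ * x))) → h =ᶠ[𝓝 0] g := by
  set R' : C(ℝ × ℝ × ℝ, ℝ) := ⟨R, hR.continuous⟩
  have hR' : ContDiff ℝ ∞ R' := hR
  have hzero : averagedEquation R' P (0, ContinuousMap.const _ P) = 0 := by
    ext s
    rw [averagedEquation_apply]
    simp [R', h0]
  obtain ⟨U, hU0, hUs, hUi⟩ := exists_implicitFunction_contDiffAt
    (contDiff_averagedEquation hR' P) hzero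
    (by
      rw [fderiv_averagedEquation hR' h1]
      exact ⟨ContinuousLinearEquiv.refl ℝ _, rfl⟩)
  simp only at hU0 hUs
  obtain ⟨δ, hδ, hball⟩ := Metric.eventually_nhds_iff_ball.1 hUi
  have hUc : ContinuousAt U 0 := hUs.self_of_nhds.continuousAt
  have hnear : ∀ᶠ x in 𝓝 (0 : ℝ), dist (U x) (ContinuousMap.const _ P) < δ := by
    have := hUc.eventually (Metric.ball_mem_nhds (U 0) hδ)
    rw [hU0] at this
    exact this
  obtain ⟨r, hr, hr'⟩ := Metric.eventually_nhds_iff_ball.1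
    (hnear.and (Metric.ball_mem_nhds (0 : ℝ) hδ))
  have hiff : ∀ x u, |x| < δ → dist u (ContinuousMap.const _ P) < δ →
      (averagedEquation R' P (x, u) = 0 ↔ U x = u) := fun x u hx hu =>
    hball (x, u) (by
      rw [Metric.mem_ball, Prod.dist_eq]
      exact max_lt (by simpa [Real.dist_eq] using hx) hu)
  have hscale : ∀ {x : ℝ} (s : unitInterval), |x| < r → |(s : ℝ) * x| < r := by
    intro x s hx
    rw [abs_mul, abs_of_nonneg s.2.1]
    exact (mul_le_of_le_one_left (abs_nonneg x) s.2.2).trans_lt hx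
  have hball' : ∀ {x : ℝ}, |x| < r → dist (U x) (ContinuousMap.const _ P) < δ ∧ |x| < δ := by
    intro x hx
    simpa [Real.dist_eq] using hr' x (by simpa [Real.dist_eq] using hx)
  have hsol : ∀ {x : ℝ}, |x| < r → averagedEquation R' P (x, U x) = 0 := fun hx =>
    (hiff _ _ (hball' hx).2 (hball' hx).1).2 rfl
  -- Dilation invariance together with uniqueness glues the solutions on different segments into the
  -- single function `x ↦ U x 1`, whose smoothness is inherited from `U`.
  have hdil : ∀ {x : ℝ} (s : unitInterval), |x| < r → U x s = U (s * x) 1 := by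
    intro x s hx
    have h2 := (hiff _ (ContinuousMap.comp (U x) ⟨fun t => t * s, by fun_prop⟩)
      (hball' (hscale s hx)).2 ?_).1 (averagedEquation_dilate (hsol hx) s)
    · rw [h2]
      simp
    · refine lt_of_le_of_lt ?_ (hball' hx).1
      rw [ContinuousMap.dist_le dist_nonneg]
      intro t
      exact ContinuousMap.dist_apply_le_dist (f := U x) (g := ContinuousMap.const _ P) (t * s)
  have hev : ∀ᶠ x in 𝓝 (0 : ℝ), ContDiffAt ℝ ∞ (fun x => U x 1) x := by
    filter_upwards [hUs] with x hx
    exact (ContinuousMap.evalCLM ℝ (1 : unitInterval)).contDiff.contDiffAt.comp x hx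
  obtain ⟨g, hg, hgU⟩ := exists_contDiff_eventuallyEq hev
  obtain ⟨ρ, hρ, hρ'⟩ := Metric.eventually_nhds_iff_ball.1 hgU
  have hgU' : ∀ {x : ℝ}, |x| < ρ → g x = U x 1 := by
    intro x hx
    exact hρ' x (by simpa [Real.dist_eq] using hx)
  refine ⟨g, hg, ?_, ?_, ?_⟩
  · rw [hgU.self_of_nhds]
    change U 0 1 = P
    rw [hU0]
    rfl
  · filter_upwards [Metric.ball_mem_nhds (0 : ℝ) (lt_min hr hρ)] with x hx
    rw [Metric.mem_ball, Real.dist_eq, sub_zero, lt_min_iff] at hx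
    have hU' : ∀ s : unitInterval, U x s = g (s * x) := by
      intro s
      rw [hdil s hx.1, hgU']
      rw [abs_mul, abs_of_nonneg s.2.1]
      exact (mul_le_of_le_one_left (abs_nonneg x) s.2.2).trans_lt hx.2
    have h3 := DFunLike.congr_fun (hsol hx.1) 1
    rw [averagedEquation_apply, ContinuousMap.zero_apply] at h3
    simp only [hU', mul_one, Set.Icc.coe_mul, Set.Icc.coe_one, one_mul, mul_assoc] at h3
    have h4 : ∀ y, R' y = R y := fun _ => rfl
    simp only [h4] at h3
    linarith
  · intro h hc hP heq
    obtain ⟨ε, hε, hε'⟩ := Metric.eventually_nhds_iff_ball.1 heq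
    -- Continuity of `h` alone makes its restrictions to short segments uniformly close to `P`,
    -- inside the domain where the implicit function is the only solution.
    have hseg : ∀ᶠ x in 𝓝 (0 : ℝ), dist (segmentMap ⟨h, hc⟩ x) (ContinuousMap.const _ P) < δ := by
      have h5 := (continuous_segmentMap ⟨h, hc⟩).continuousAt (x := 0)
      have h6 : segmentMap ⟨h, hc⟩ 0 = ContinuousMap.const _ P := by
        ext s
        simp [segmentMap, hP]
      have h7 := h5.eventually (Metric.ball_mem_nhds _ hδ)
      rw [h6] at h7
      exact h7
    filter_upwards [Metric.ball_mem_nhds (0 : ℝ) (lt_min hδ hε), hseg, hgU] with x hx hs hgx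
    rw [Metric.mem_ball, Real.dist_eq, sub_zero, lt_min_iff] at hx
    have h8 : averagedEquation R' P (x, segmentMap ⟨h, hc⟩ x) = 0 := by
      ext s
      rw [averagedEquation_segmentMap, ContinuousMap.zero_apply]
      have h9 := hε' (s * x) (by
        rw [Metric.mem_ball, Real.dist_eq, sub_zero, abs_mul, abs_of_nonneg s.2.1]
        exact (mul_le_of_le_one_left (abs_nonneg x) s.2.2).trans_lt hx.2)
      simp only [ContinuousMap.coe_mk, R']
      linarith
    rw [hgx, (hiff _ _ hx.1 hs).1 h8]
    simp [segmentMap]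

/-! ### Means, integrals, and division by `x` after the blow-up. -/

theorem eventually_forall_uIcc {p : ℝ → Prop} (h : ∀ᶠ x in 𝓝 (0 : ℝ), p x) :
    ∀ᶠ x in 𝓝 (0 : ℝ), ∀ t ∈ uIcc 0 x, p t := by
  obtain ⟨r, hr, H⟩ := Metric.eventually_nhds_iff_ball.1 h
  filter_upwards [Metric.ball_mem_nhds (0 : ℝ) hr] with x hx t ht
  refine H t ((convex_ball (0 : ℝ) r).ordConnected.uIcc_subset (Metric.mem_ball_self hr) hx ht)

theorem integral_unitInterval (f : ℝ → ℝ) :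
    ∫ σ : unitInterval, f σ = ∫ t in (0 : ℝ)..1, f t := by
  rw [intervalIntegral.integral_of_le zero_le_one, ← MeasureTheory.integral_Icc_eq_integral_Ioc]
  exact MeasureTheory.integral_subtype measurableSet_Icc f

theorem mul_integral_unitInterval (f : ℝ → ℝ) (x : ℝ) :
    x * ∫ σ : unitInterval, f (σ * x) = ∫ t in (0 : ℝ)..x, f t := by
  rw [integral_unitInterval (fun t => f (t * x)), intervalIntegral.mul_integral_comp_mul_right]
  simp

theorem continuous_integral_unitInterval {f : ℝ → ℝ} (hf : Continuous f) :
    Continuous fun x : ℝ => ∫ σ : unitInterval, f (σ * x) := by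
  have := continuous_parametric_integral_of_continuous
    (μ := (MeasureTheory.volume : MeasureTheory.Measure unitInterval))
    (f := fun (x : ℝ) (σ : unitInterval) => f (σ * x)) (by fun_prop) isCompact_univ
  simpa using this

/-- Hadamard's lemma along the blow-up `(x, η) ↦ (x, x η)`. -/
theorem exists_contDiff_blowup {f : ℝ × ℝ → ℝ} (hf : ContDiff ℝ ∞ f) (h0 : f 0 = 0) :
    ∃ D : ℝ × ℝ → ℝ, ContDiff ℝ ∞ D ∧ (∀ x η, f (x, x * η) = x * D (x, η)) ∧
      ∀ η, D (0, η) = fderiv ℝ f 0 (1, η) := by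
  have hF : ContDiff ℝ ∞ fun z : ℝ × ℝ × ℝ => fderiv ℝ f (z.1, z.2.1) (1, z.2.2) := by
    have : ContDiff ℝ ∞ (fderiv ℝ f) := (contDiff_infty_iff_fderiv.1 hf).2
    exact (this.comp (contDiff_fst.prodMk (contDiff_fst.comp contDiff_snd))).clm_apply
      (contDiff_const.prodMk (contDiff_snd.comp contDiff_snd))
  set F : C(ℝ × ℝ × ℝ, ℝ) := ⟨_, hF.continuous⟩
  let L : ℝ × ℝ × ℝ →ₗ[ℝ] C(unitInterval, ℝ × ℝ × ℝ) :=
    { toFun := fun z => ⟨fun s => ((s : ℝ) * z.1, (s : ℝ) * z.2.1, z.2.2), by fun_prop⟩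
      map_add' := fun u v => by ext s <;> simp [mul_add]
      map_smul' := fun c u => by ext s <;> simp [mul_left_comm] }
  -- The quotient is `D(x, η) = ∫₀¹ df(σx, σxη)(1, η) dσ`; realized through bounded operators and a
  -- composition operator, it is smooth at once.
  refine ⟨fun z => averageCLM (F.comp (LinearMap.toContinuousLinearMap L (z.1, z.1 * z.2, z.2))) 1,
    ?_, ?_, ?_⟩
  · refine (ContinuousMap.evalCLM ℝ (1 : unitInterval)).contDiff.comp (averageCLM.contDiff.comp
      ((F.contDiff_comp hF).comp ((LinearMap.toContinuousLinearMap L).contDiff.comp ?_)))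
    fun_prop
  · intro x η
    have h1 : averageCLM (F.comp (LinearMap.toContinuousLinearMap L (x, x * η, η))) 1 =
        ∫ σ : unitInterval, fderiv ℝ f (σ * x, σ * (x * η)) (1, η) := by
      rw [averageCLM_apply]
      simp only [mul_one]
      rfl
    simp only [h1]
    rw [integral_unitInterval (fun t => fderiv ℝ f (t * x, t * (x * η)) (1, η)),
      ← intervalIntegral.integral_const_mul]
    have h2 : ∀ t : ℝ, HasDerivAt (fun t : ℝ => f (t * x, t * (x * η)))
        (x * fderiv ℝ f (t * x, t * (x * η)) (1, η)) t := by
      intro t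
      have h3 : HasDerivAt (fun t : ℝ => (t * x, t * (x * η))) (x, x * η) t :=
        (by simpa using (hasDerivAt_id t).mul_const x : HasDerivAt (fun t : ℝ => t * x) x t).prodMk
          (by simpa using (hasDerivAt_id t).mul_const (x * η))
      have h4 := ((hf.differentiable (by simp) (t * x, t * (x * η))).hasFDerivAt).comp_hasDerivAt t h3
      have h5 : ((x, x * η) : ℝ × ℝ) = x • (1, η) := by simp
      rwa [h5, map_smul, smul_eq_mul] at h4
    rw [intervalIntegral.integral_eq_sub_of_hasDerivAt (fun t _ => h2 t)]
    · have : ((0 : ℝ), (0 : ℝ)) = 0 := rfl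
      simp [this, h0]
    · refine Continuous.intervalIntegrable ?_ _ _
      have h6 : Continuous (fderiv ℝ f) := hf.continuous_fderiv (by simp)
      fun_prop
  · intro η
    change averageCLM (F.comp (LinearMap.toContinuousLinearMap L (0, 0 * η, η))) 1 = _
    rw [averageCLM_apply]
    have h1 : ∀ σ : unitInterval, (F.comp (LinearMap.toContinuousLinearMap L
        (0, 0 * η, η))) (σ * 1) = fderiv ℝ f 0 (1, η) := by
      intro σ
      change fderiv ℝ f ((((σ * 1 : unitInterval) : ℝ) * 0),
        (((σ * 1 : unitInterval) : ℝ) * (0 * η))) (1, η) = _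
      simp only [zero_mul, mul_zero]
      rfl
    simp only [h1]
    simp

/-- The difference quotient at `0` is `f` itself, so continuity suffices. This lets the
differentiated equation extend across the singular point. -/
theorem hasDerivAt_mul_of_continuousAt {f : ℝ → ℝ} (hf : ContinuousAt f 0) :
    HasDerivAt (fun x => x * f x) (f 0) 0 := by
  rw [hasDerivAt_iff_tendsto_slope_zero]
  refine (hf.tendsto.mono_left nhdsWithin_le_nhds).congr' ?_
  filter_upwards [self_mem_nhdsWithin] with t ht
  have : t ≠ 0 := ht
  simp [this]

/-! ### The singular second-order equation. -/

/-- The equation `2 Δ(x, y) y'' = N(x, y, y')` at a point where `Δ` and `N` vanish, in the case of a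
saddle of trace zero: there is exactly one solution with the given slope, and it is smooth. -/
theorem exists_contDiff_solution_of_saddle {Δ : ℝ × ℝ → ℝ} {N : (ℝ × ℝ) × ℝ → ℝ} {P d : ℝ}
    (hΔ : ∀ᶠ z in 𝓝 (0 : ℝ × ℝ), ContDiffAt ℝ ∞ Δ z)
    (hN : ∀ᶠ z in 𝓝 ((0 : ℝ × ℝ), P), ContDiffAt ℝ ∞ N z)
    (hΔ0 : Δ 0 = 0) (hN0 : N (0, P) = 0) (hd : fderiv ℝ Δ 0 (1, P) = d) (hd0 : d ≠ 0)
    (hNd : HasDerivAt (fun p => N (0, p)) (-2 * d) P) :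
    ∃ y : ℝ → ℝ, ContDiff ℝ ∞ y ∧ y 0 = 0 ∧ deriv y 0 = P ∧
      (∀ᶠ x in 𝓝[≠] 0, Δ (x, y x) ≠ 0 ∧
        2 * Δ (x, y x) * deriv (deriv y) x = N ((x, y x), deriv y x)) ∧
      (∃ᶠ x in 𝓝 0, 0 < Δ (x, y x)) ∧
      ∀ w h : ℝ → ℝ, w 0 = 0 → h 0 = P → (∀ᶠ x in 𝓝 0, HasDerivAt w (h x) x) →
        (∀ᶠ x in 𝓝 0, ContinuousAt h x) →
        (∀ᶠ x in 𝓝[≠] 0, ∃ h', HasDerivAt h h' x ∧ 2 * Δ (x, w x) * h' = N ((x, w x), h x)) →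
        w =ᶠ[𝓝 0] y := by
  obtain ⟨Δ', hΔ', hΔe⟩ := exists_contDiff_eventuallyEq hΔ
  obtain ⟨N', hN', hNe⟩ := exists_contDiff_eventuallyEq hN
  obtain ⟨D, hD, hDΔ, hD0⟩ := exists_contDiff_blowup hΔ' (hΔe.self_of_nhds.trans hΔ0)
  have hDP : D (0, P) = d := by rw [hD0, hΔe.fderiv_eq, hd]
  -- In the variables `(x, η, h)` the equation reads `x h' = N/(2D)`; adding `h - P` turns the left
  -- side into `(x(h - P))'`.
  set R₀ : ℝ × ℝ × ℝ → ℝ := fun z =>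
    N' ((z.1, z.1 * z.2.1), z.2.2) / (2 * D (z.1, z.2.1)) + (z.2.2 - P) with hR₀
  have hDc : Continuous D := hD.continuous
  have hDne : ∀ᶠ z in 𝓝 ((0 : ℝ), P, P), D (z.1, z.2.1) ≠ 0 := by
    have hc : Continuous fun z : ℝ × ℝ × ℝ => D (z.1, z.2.1) := by fun_prop
    exact hc.continuousAt.eventually_ne (by simpa [hDP] using hd0)
  have hR₀s : ∀ᶠ z in 𝓝 ((0 : ℝ), P, P), ContDiffAt ℝ ∞ R₀ z := by
    filter_upwards [hDne] with z hz
    have h1 : ContDiff ℝ ∞ fun z : ℝ × ℝ × ℝ => N' ((z.1, z.1 * z.2.1), z.2.2) :=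
      hN'.comp (by fun_prop)
    have h2 : ContDiff ℝ ∞ fun z : ℝ × ℝ × ℝ => 2 * D (z.1, z.2.1) :=
      contDiff_const.mul (hD.comp (by fun_prop))
    exact (h1.contDiffAt.div h2.contDiffAt (mul_ne_zero two_ne_zero hz)).add
      (by fun_prop)
  obtain ⟨R, hR, hRe⟩ := exists_contDiff_eventuallyEq hR₀s
  have hN'0 : N' ((0, 0), P) = 0 := hNe.self_of_nhds.trans hN0
  have hR0 : R (0, P, P) = 0 := by
    rw [hRe.self_of_nhds]
    simp [hR₀, hN'0]
  -- In the `h` direction the derivative is `-2d/(2d) + 1 = 0`. In the `η` direction, at `x = 0` the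
  -- numerator does not see `η`, and the variation of the denominator is multiplied by `N = 0`.
  have hRd : ∀ v : ℝ × ℝ, fderiv ℝ R (0, P, P) (0, v) = 0 := by
    rintro ⟨k, l⟩
    rw [hRe.fderiv_eq]
    have hline : ∀ c e : ℝ, HasDerivAt (fun t : ℝ => c + t * e) e 0 := fun c e => by
      simpa using ((hasDerivAt_id (0 : ℝ)).mul_const e).const_add c
    have h1 : HasDerivAt (fun t : ℝ => ((0 : ℝ), P + t * k, P + t * l)) (0, k, l) 0 :=
      (hasDerivAt_const _ _).prodMk ((hline P k).prodMk (hline P l))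
    have h2 : HasFDerivAt R₀ (fderiv ℝ R₀ (0, P, P)) ((0 : ℝ), P + 0 * k, P + 0 * l) := by
      simpa using (hR₀s.self_of_nhds.differentiableAt (by simp)).hasFDerivAt
    have h3 := h2.comp_hasDerivAt (0 : ℝ) h1
    have h4 : HasDerivAt (fun p => N' ((0, 0), p)) (-2 * d) P := by
      refine hNd.congr_of_eventuallyEq ?_
      have : Tendsto (fun p : ℝ => ((0 : ℝ × ℝ), p)) (𝓝 P) (𝓝 (0, P)) :=
        (by fun_prop : Continuous fun p : ℝ => ((0 : ℝ × ℝ), p)).continuousAt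
      exact this.eventually hNe
    have h5 : HasDerivAt (fun t : ℝ => N' ((0, 0), P + t * l)) (-2 * d * l) 0 := by
      have h4' : HasDerivAt (fun p => N' ((0, 0), p)) (-2 * d) (P + 0 * l) := by simpa using h4
      exact h4'.comp (0 : ℝ) (hline P l)
    have h6 : HasFDerivAt D (fderiv ℝ D (0, P)) ((0 : ℝ), P + 0 * k) := by
      simpa using (hD.differentiable (by simp) (0, P)).hasFDerivAt
    have h7 := (h6.comp_hasDerivAt (0 : ℝ) ((hasDerivAt_const (0 : ℝ) (0 : ℝ)).prodMk
      (hline P k))).const_mul 2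
    have h8 := (h5.div h7 (by simpa [hDP] using hd0)).add ((hline P l).sub_const P)
    have h9 : (R₀ ∘ fun t : ℝ => ((0 : ℝ), P + t * k, P + t * l)) =
        fun t : ℝ => N' ((0, 0), P + t * l) / (2 * D (0, P + t * k)) + (P + t * l - P) := by
      funext t
      simp [hR₀]
    rw [h9] at h3
    rw [h3.unique h8]
    simp only [zero_mul, add_zero, Function.comp_apply, hDP, hN'0]
    field_simp
    ring
  have hgood : ∀ {h : ℝ → ℝ}, Continuous h → h 0 = P → ∀ᶠ x in 𝓝 (0 : ℝ),
      ∀ η, η = (∫ σ : unitInterval, h (σ * x)) → R (x, η, h x) = R₀ (x, η, h x) ∧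
        D (x, η) ≠ 0 ∧ 0 < D (x, η) * d ∧ Δ' (x, x * η) = Δ (x, x * η) ∧
        N' ((x, x * η), h x) = N ((x, x * η), h x) := by
    intro h hc hP
    have hη := continuous_integral_unitInterval hc
    have hη0 : ∫ σ : unitInterval, h (σ * 0) = P := by simp [hP]
    have e1 : Tendsto (fun x : ℝ => (x, (∫ σ : unitInterval, h (σ * x)), h x)) (𝓝 0)
        (𝓝 (0, P, P)) := by
      have := (continuous_id.prodMk (hη.prodMk hc)).tendsto (0 : ℝ)
      simpa only [hη0, hP, id] using this
    have e2 : Tendsto (fun x : ℝ => (x, x * (∫ σ : unitInterval, h (σ * x)))) (𝓝 0) (𝓝 0) := by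
      have := (by fun_prop : Continuous fun x : ℝ =>
        (x, x * (∫ σ : unitInterval, h (σ * x)))).tendsto (0 : ℝ)
      rw [zero_mul] at this
      exact this
    have e3 : Tendsto (fun x : ℝ => ((x, x * (∫ σ : unitInterval, h (σ * x))), h x)) (𝓝 0)
        (𝓝 (0, P)) := e2.prodMk_nhds (by simpa [hP] using hc.tendsto 0)
    have e4 : ∀ᶠ x in 𝓝 (0 : ℝ), 0 < D (x, ∫ σ : unitInterval, h (σ * x)) * d := by
      have hc' : Continuous fun x : ℝ => D (x, ∫ σ : unitInterval, h (σ * x)) * d := by fun_prop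
      have := hc'.continuousAt (x := 0)
      refine this.eventually (lt_mem_nhds ?_)
      change 0 < D (0, ∫ σ : unitInterval, h (σ * 0)) * d
      rw [hη0, hDP]
      exact mul_self_pos.2 hd0
    filter_upwards [e1.eventually hRe, e1.eventually hDne, e2.eventually hΔe, e3.eventually hNe, e4]
      with x h1 h2 h3 h4 h5
    rintro _ rfl
    exact ⟨h1, h2, h5, h3, h4⟩
  obtain ⟨g, hg, hg0, hgeq, hguniq⟩ := exists_contDiff_averaged_solution hR hR0 hRd
  have hgc := hg.continuous
  have hRc := hR.continuous
  have hyd : ∀ x, HasDerivAt (fun x => ∫ t in (0 : ℝ)..x, g t) (g x) x := fun x =>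
    intervalIntegral.integral_hasDerivAt_right (hgc.intervalIntegrable _ _)
      (hgc.stronglyMeasurableAtFilter _ _) hgc.continuousAt
  have hyd' : deriv (fun x => ∫ t in (0 : ℝ)..x, g t) = g := funext fun x => (hyd x).deriv
  have hRcont : ∀ {h : ℝ → ℝ}, Continuous h → Continuous fun t =>
      R (t, (∫ τ : unitInterval, h (τ * t)), h t) := fun hc => by
    have := continuous_integral_unitInterval hc
    fun_prop
  refine ⟨fun x => ∫ t in (0 : ℝ)..x, g t, ?_, by simp, by rw [hyd', hg0], ?_, ?_, ?_⟩
  · rw [contDiff_infty_iff_deriv, hyd']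
    exact ⟨fun x => (hyd x).differentiableAt, hg⟩
  · rw [hyd']
    -- Multiplying the averaged equation by `x` exhibits `x(g - P)` as a primitive of `R`;
    -- differentiating it recovers the differential equation.
    have hint : (fun x => x * (g x - P)) =ᶠ[𝓝 0] fun x => ∫ t in (0 : ℝ)..x,
        R (t, (∫ τ : unitInterval, g (τ * t)), g t) := by
      filter_upwards [hgeq] with x hx
      rw [← mul_integral_unitInterval (fun t => R (t, (∫ τ : unitInterval, g (τ * t)), g t)), hx]
      ring
    have hmain : ∀ᶠ x in 𝓝 (0 : ℝ), x ≠ 0 → Δ (x, ∫ t in (0 : ℝ)..x, g t) ≠ 0 ∧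
        2 * Δ (x, ∫ t in (0 : ℝ)..x, g t) * deriv g x =
          N ((x, ∫ t in (0 : ℝ)..x, g t), g x) := by
      filter_upwards [hint.eventually_nhds, hgood hgc hg0] with x hx hgx hx0
      obtain ⟨h1, h2, -, h3, h4⟩ := hgx _ rfl
      have h5 := (hasDerivAt_id x).mul ((hg.differentiable (by simp) x).hasDerivAt.sub_const P)
      have h6 : HasDerivAt (fun x => ∫ t in (0 : ℝ)..x,
          R (t, (∫ τ : unitInterval, g (τ * t)), g t)) _ x :=
        intervalIntegral.integral_hasDerivAt_right ((hRcont hgc).intervalIntegrable _ _)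
          ((hRcont hgc).stronglyMeasurableAtFilter _ _) (hRcont hgc).continuousAt
      have h7 := (h6.congr_of_eventuallyEq hx).unique h5
      rw [h1] at h7
      rw [← mul_integral_unitInterval g, ← h3, ← h4, hDΔ]
      refine ⟨mul_ne_zero hx0 h2, ?_⟩
      simp only [hR₀, id] at h7
      have h8 : N' ((x, x * ∫ σ : unitInterval, g (σ * x)), g x) /
          (2 * D (x, ∫ σ : unitInterval, g (σ * x))) = x * deriv g x := by linarith
      rw [div_eq_iff (mul_ne_zero two_ne_zero h2)] at h8
      rw [h8]
      ring
    exact eventually_nhdsWithin_iff.2 hmain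
  · have hsign : ∀ᶠ x in 𝓝 (0 : ℝ), 0 < x * d → 0 < Δ (x, ∫ t in (0 : ℝ)..x, g t) := by
      filter_upwards [hgood hgc hg0] with x hgx hx0
      obtain ⟨-, -, h2, h3, -⟩ := hgx _ rfl
      rw [← mul_integral_unitInterval g, ← h3, hDΔ]
      have h4 := mul_pos hx0 h2
      have h5 : 0 < d ^ 2 := by positivity
      refine pos_of_mul_pos_left ?_ h5.le
      nlinarith
    -- The sign of `d` decides on which side of `0` the discriminant is positive.
    rcases lt_or_gt_of_ne hd0 with hd' | hd'
    · have : ∀ᶠ x in 𝓝[<] (0 : ℝ), 0 < Δ (x, ∫ t in (0 : ℝ)..x, g t) := by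
        filter_upwards [hsign.filter_mono nhdsWithin_le_nhds, self_mem_nhdsWithin] with x hx hx'
        exact hx (mul_pos_of_neg_of_neg hx' hd')
      exact this.frequently.filter_mono nhdsWithin_le_nhds
    · have : ∀ᶠ x in 𝓝[>] (0 : ℝ), 0 < Δ (x, ∫ t in (0 : ℝ)..x, g t) := by
        filter_upwards [hsign.filter_mono nhdsWithin_le_nhds, self_mem_nhdsWithin] with x hx hx'
        exact hx (mul_pos hx' hd')
      exact this.frequently.filter_mono nhdsWithin_le_nhds
  · intro w h hw0 hh0 hw hhc hode
    obtain ⟨ρ, hρ, hρc⟩ := Metric.eventually_nhds_iff_ball.1 hhc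
    -- Clamping the argument gives a globally continuous function with the same germ, as the
    -- uniqueness statement requires.
    set H : ℝ → ℝ := fun x => h (max (-(ρ / 2)) (min (ρ / 2) x)) with hH
    have hHc : Continuous H := by
      refine continuous_iff_continuousAt.2 fun x => ContinuousAt.comp (hρc _ ?_) (by fun_prop)
      rw [Metric.mem_ball, Real.dist_eq, sub_zero, abs_lt]
      refine ⟨lt_of_lt_of_le (by linarith) (le_max_left _ _), max_lt (by linarith) ?_⟩
      exact (min_le_left _ _).trans_lt (by linarith)
    have hHh : H =ᶠ[𝓝 0] h := by
      filter_upwards [Ioo_mem_nhds (by linarith : -(ρ / 2) < 0) (by linarith : 0 < ρ / 2)] with x hx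
      simp only [hH]
      rw [min_eq_right hx.2.le, max_eq_right hx.1.le]
    have hH0 : H 0 = P := hHh.self_of_nhds.trans hh0
    have hwH : ∀ᶠ x in 𝓝 (0 : ℝ), w x = ∫ t in (0 : ℝ)..x, H t := by
      filter_upwards [eventually_forall_uIcc (hw.and hHh)] with x hx
      rw [intervalIntegral.integral_eq_sub_of_hasDerivAt
        (fun t ht => by rw [(hx t ht).2]; exact (hx t ht).1) (hHc.intervalIntegrable _ _), hw0,
        sub_zero]
    have hode' := eventually_nhdsWithin_iff.1 hode
    -- The equation is given only for `x ≠ 0`, but `x(H - P)` is also differentiable at `0`, with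
    -- derivative `H 0 - P = 0 = R(0, P, P)`. Integration from `0` is then legitimate.
    have hderiv : ∀ᶠ x in 𝓝 (0 : ℝ), HasDerivAt (fun x => x * (H x - P))
        (R (x, (∫ τ : unitInterval, H (τ * x)), H x)) x := by
      filter_upwards [hode', hwH, hHh.eventually_nhds, hgood hHc hH0] with x hx hwx hHx hgx
      rcases eq_or_ne x 0 with rfl | hx0
      · have h1 := hasDerivAt_mul_of_continuousAt
          (hHc.sub (continuous_const (y := P))).continuousAt
        have h2 : R (0, (∫ τ : unitInterval, H (τ * 0)), H 0) = H 0 - P := by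
          simp [hH0, hR0]
        rwa [h2]
      · obtain ⟨h1, h2, -, h3, h4⟩ := hgx _ rfl
        obtain ⟨h', hh', heq⟩ := hx hx0
        have h5 := (hasDerivAt_id x).mul ((hh'.congr_of_eventuallyEq hHx).sub_const P)
        refine h5.congr_deriv ?_
        have hHx' : H x = h x := hHx.self_of_nhds
        rw [hwx, ← mul_integral_unitInterval H, ← h3, ← hHx', ← h4, hDΔ] at heq
        rw [h1, hR₀]
        have h8 : ∀ e : ℝ, e ≠ 0 → 2 * (x * e) * h' / (2 * e) = x * h' := fun e he => by
          field_simp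
        simp only [id, ← heq, h8 _ h2]
        ring
    have hHeq : ∀ᶠ x in 𝓝 (0 : ℝ), H x = P + ∫ σ : unitInterval, R (σ * x,
        ∫ τ : unitInterval, H (τ * (σ * x)), H (σ * x)) := by
      filter_upwards [eventually_forall_uIcc hderiv] with x hx
      rcases eq_or_ne x 0 with rfl | hx0
      · simp [hH0, hR0]
      · have h1 := intervalIntegral.integral_eq_sub_of_hasDerivAt hx
          ((hRcont hHc).intervalIntegrable _ _)
        rw [← mul_integral_unitInterval
          (fun t => R (t, (∫ τ : unitInterval, H (τ * t)), H t)), zero_mul, sub_zero] at h1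
        have h2 := mul_left_cancel₀ hx0 h1
        linarith
    filter_upwards [hwH, eventually_forall_uIcc (hguniq H hHc hH0 hHeq)] with x hx hx'
    rw [hx]
    exact intervalIntegral.integral_congr hx'

/-! ### From parametrized plane curves to graphs. -/

/-- A regular parametrized solution of `2 Δ p' = N(x, y, p) x'`, `p = dy/dx`, lies on the graph of
the solution of the corresponding ordinary differential equation. -/
theorem eventually_mem_graph_of_ode {Δ : ℝ × ℝ → ℝ} {N : (ℝ × ℝ) × ℝ → ℝ} {P : ℝ} {y : ℝ → ℝ}
    (huniq : ∀ w h : ℝ → ℝ, w 0 = 0 → h 0 = P → (∀ᶠ x in 𝓝 0, HasDerivAt w (h x) x) →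
        (∀ᶠ x in 𝓝 0, ContinuousAt h x) →
        (∀ᶠ x in 𝓝[≠] 0, ∃ h', HasDerivAt h h' x ∧ 2 * Δ (x, w x) * h' = N ((x, w x), h x)) →
        w =ᶠ[𝓝 0] y)
    {X W : ℝ → ℝ} {ε : ℝ} (hε : 0 < ε) (hX : ContDiffOn ℝ 1 X (Ioo (-ε) ε))
    (hW : ContDiffOn ℝ 1 W (Ioo (-ε) ε)) (hX0 : X 0 = 0) (hW0 : W 0 = 0) (hX' : deriv X 0 ≠ 0)
    (hP : deriv W 0 / deriv X 0 = P)
    (hode : ∀ᶠ t in 𝓝[≠] 0, ∃ p', HasDerivAt (fun s => deriv W s / deriv X s) p' t ∧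
      2 * Δ (X t, W t) * p' = N ((X t, W t), deriv W t / deriv X t) * deriv X t) :
    ∀ᶠ t in 𝓝 0, W t = y (X t) := by
  have hmem : Ioo (-ε) ε ∈ 𝓝 (0 : ℝ) := Ioo_mem_nhds (by linarith) hε
  have hXat := hX.contDiffAt hmem
  have hXd : HasFDerivAt X ((ContinuousLinearEquiv.unitsEquivAut ℝ (Units.mk0 _ hX') :
      ℝ ≃L[ℝ] ℝ) : ℝ →L[ℝ] ℝ) 0 := by
    have h1 := (hXat.differentiableAt (by simp)).hasDerivAt.hasFDerivAt
    refine h1.congr_fderiv ?_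
    ext
    simp
  -- The local inverse of `X` serves to reparametrize by `x`; the slope is then a continuous
  -- function of `x`, differentiable off `0`, to which `huniq` applies.
  set e := hXat.toOpenPartialHomeomorph X hXd one_ne_zero
  have heX : ∀ t, e t = X t := fun _ => rfl
  have h0s : (0 : ℝ) ∈ e.source := hXat.mem_toOpenPartialHomeomorph_source hXd one_ne_zero
  have h0t : (0 : ℝ) ∈ e.target := by
    have := e.map_source h0s
    rwa [heX, hX0] at this
  have hs0 : e.symm 0 = 0 := by
    have := e.left_inv h0s
    rwa [heX, hX0] at this
  have hsc : Tendsto e.symm (𝓝 0) (𝓝 0) := by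
    have := e.continuousAt_symm h0t
    rwa [ContinuousAt, hs0] at this
  have hderX := hX.continuousOn_deriv_of_isOpen isOpen_Ioo le_rfl
  have hderW := hW.continuousOn_deriv_of_isOpen isOpen_Ioo le_rfl
  have hne : ∀ᶠ t in 𝓝 (0 : ℝ), deriv X t ≠ 0 :=
    (hderX.continuousAt hmem).eventually_ne hX'
  have hsymm : ∀ᶠ x in 𝓝 (0 : ℝ), HasDerivAt e.symm (deriv X (e.symm x))⁻¹ x := by
    filter_upwards [hsc.eventually (eventually_mem_nhds_iff.2 hmem), hsc.eventually hne,
      e.open_target.mem_nhds h0t] with x hx1 hx2 hx3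
    exact e.hasDerivAt_symm hx3 hx2
      ((hX.contDiffAt hx1).differentiableAt (by simp)).hasDerivAt
  have key := huniq (W ∘ e.symm) (fun x => deriv W (e.symm x) / deriv X (e.symm x))
    (by simp [hs0, hW0]) (by simp only [hs0, hP]) ?_ ?_ ?_
  · have hXc : Tendsto X (𝓝 0) (𝓝 0) := by
      have := hXat.continuousAt
      rwa [ContinuousAt, hX0] at this
    filter_upwards [hXc.eventually key, e.open_source.mem_nhds h0s] with t ht hts
    have h2 := e.left_inv hts
    rw [heX] at h2
    rw [← ht, Function.comp_apply, h2]
  · filter_upwards [hsc.eventually (eventually_mem_nhds_iff.2 hmem), hsymm] with x hx1 hx2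
    rw [div_eq_mul_inv]
    exact ((hW.contDiffAt hx1).differentiableAt (by simp)).hasDerivAt.comp x hx2
  · filter_upwards [hsc.eventually (eventually_mem_nhds_iff.2 hmem), hsymm, hsc.eventually hne]
      with x hx1 hx2 hx3
    exact ((hderW.continuousAt hx1).comp hx2.continuousAt).div
      ((hderX.continuousAt hx1).comp hx2.continuousAt) hx3
  · rw [eventually_nhdsWithin_iff] at hode ⊢
    filter_upwards [hsc.eventually hode, hsymm, hsc.eventually hne, e.open_target.mem_nhds h0t]
      with x hx1 hx2 hx3 hx4 hx0
    have hr : X (e.symm x) = x := e.right_inv hx4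
    have hx5 : e.symm x ≠ 0 := fun h => by
      rw [h, hX0] at hr
      exact hx0 hr.symm
    obtain ⟨p', hp', heq⟩ := hx1 hx5
    refine ⟨_, hp'.comp x hx2, ?_⟩
    rw [hr] at heq
    rw [← mul_assoc, Function.comp_apply, heq, mul_assoc, mul_inv_cancel₀ hx3, mul_one]

theorem hasDerivAt_coord {z : ℝ → Plane} {v : Plane} {t : ℝ} (h : HasDerivAt z v t) (i : Fin 2) :
    HasDerivAt (fun s => z s i) (v i) t :=
  (EuclideanSpace.proj i : Plane →L[ℝ] ℝ).hasFDerivAt.comp_hasDerivAt t h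

/-- The affine parametrization of the plane centred at `q`, in which the `i`-th coordinate comes
first. -/
noncomputable def planeFrame (q : Plane) (i j : Fin 2) (z : ℝ × ℝ) : Plane :=
  q + (z.1 • EuclideanSpace.single i (1 : ℝ) + z.2 • EuclideanSpace.single j (1 : ℝ))

theorem planeFrame_fst {q : Plane} {i j : Fin 2} (hij : i ≠ j) (z : ℝ × ℝ) :
    planeFrame q i j z i = q i + z.1 := by
  simp [planeFrame, hij]

theorem planeFrame_snd {q : Plane} {i j : Fin 2} (hij : i ≠ j) (z : ℝ × ℝ) :
    planeFrame q i j z j = q j + z.2 := by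
  simp [planeFrame, hij.symm]

theorem Plane.ext_of_ne {i j : Fin 2} (hij : i ≠ j) {u v : Plane} (hi : u i = v i)
    (hj : u j = v j) : u = v := by
  ext k
  have : k = i ∨ k = j := by omega
  rcases this with rfl | rfl <;> assumption

theorem planeFrame_sub {q : Plane} {i j : Fin 2} (hij : i ≠ j) (u : Plane) :
    planeFrame q i j (u i - q i, u j - q j) = u :=
  Plane.ext_of_ne hij (by rw [planeFrame_fst hij]; ring) (by rw [planeFrame_snd hij]; ring)

theorem contDiff_planeFrame (q : Plane) (i j : Fin 2) : ContDiff ℝ ∞ (planeFrame q i j) := by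
  unfold planeFrame
  fun_prop

theorem planeFrame_zero (q : Plane) (i j : Fin 2) : planeFrame q i j 0 = q := by
  simp [planeFrame]

theorem hasFDerivAt_planeFrame (q : Plane) (i j : Fin 2) (z : ℝ × ℝ) :
    HasFDerivAt (planeFrame q i j)
      ((ContinuousLinearMap.fst ℝ ℝ ℝ).smulRight (EuclideanSpace.single i (1 : ℝ)) +
        (ContinuousLinearMap.snd ℝ ℝ ℝ).smulRight (EuclideanSpace.single j (1 : ℝ))) z :=
  ((hasFDerivAt_fst.smul_const _).add (hasFDerivAt_snd.smul_const _)).const_add q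

/-- Existence and uniqueness of the integral curve of the lifted direction field through a saddle
of trace zero, for a direction at which the `i`-th coordinate can be used as the parameter. -/
theorem MetricCoeffs.exists_integral_curve {m : MetricCoeffs} {q : Plane} {i j : Fin 2}
    (hij : i ≠ j) {N : Plane × ℝ → ℝ} {P d : ℝ}
    (hΔ : ∀ᶠ z in 𝓝 q, ContDiffAt ℝ ∞ m.disc z)
    (hN : ∀ᶠ ξ in 𝓝 (q, P), ContDiffAt ℝ ∞ N ξ)
    (hΔ0 : m.disc q = 0) (hN0 : N (q, P) = 0)
    (hd : fderiv ℝ m.disc q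
      (EuclideanSpace.single i (1 : ℝ) + P • EuclideanSpace.single j (1 : ℝ)) = d)
    (hd0 : d ≠ 0) (hNd : HasDerivAt (fun p => N (q, p)) (-2 * d) P)
    (hlift : ∀ (z : ℝ → Plane) (t : ℝ), DifferentiableAt ℝ z t → deriv z t i ≠ 0 →
      (m.LiftTangentAt z t ↔ m.disc (z t) ≠ 0 ∧
        ∃ p', HasDerivAt (fun s => deriv z s j / deriv z s i) p' t ∧
          2 * m.disc (z t) * p' = N (z t, deriv z t j / deriv z t i) * deriv z t i)) :
    ∃ z : ℝ → Plane, ContDiff ℝ ∞ z ∧ z 0 = q ∧ (∀ t, deriv z t i = 1) ∧ deriv z 0 j = P ∧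
      (∀ᶠ t in 𝓝[≠] 0, m.LiftTangentAt z t) ∧ (∃ᶠ t in 𝓝 0, 0 < m.disc (z t)) ∧
      ∀ (ζ : ℝ → Plane) (ε : ℝ), 0 < ε → ContDiffOn ℝ 1 ζ (Ioo (-ε) ε) → ζ 0 = q →
        deriv ζ 0 i ≠ 0 → deriv ζ 0 j / deriv ζ 0 i = P →
        (∀ t ∈ Ioo (-ε) ε, t ≠ 0 → m.LiftTangentAt ζ t) →
        ∀ᶠ t in 𝓝 0, ζ t = z (ζ t i - q i) := by
  have hι := contDiff_planeFrame q i j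
  have hι0 := planeFrame_zero q i j
  have hιc : Tendsto (planeFrame q i j) (𝓝 0) (𝓝 q) := by
    have := hι.continuous.tendsto 0
    rwa [hι0] at this
  have hιc' : Tendsto (fun ξ : (ℝ × ℝ) × ℝ => (planeFrame q i j ξ.1, ξ.2)) (𝓝 (0, P))
      (𝓝 (q, P)) := by
    have := (by have := hι.continuous; fun_prop :
      Continuous fun ξ : (ℝ × ℝ) × ℝ => (planeFrame q i j ξ.1, ξ.2)).tendsto (0, P)
    rwa [hι0] at this
  obtain ⟨y, hy, hy0, hy0', hyode, hypos, hyuniq⟩ := exists_contDiff_solution_of_saddle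
    (Δ := fun z => m.disc (planeFrame q i j z)) (N := fun ξ => N (planeFrame q i j ξ.1, ξ.2))
    (P := P) (d := d)
    (by
      filter_upwards [hιc.eventually hΔ] with z hz
      exact hz.comp z hι.contDiffAt)
    (by
      filter_upwards [hιc'.eventually hN] with ξ hξ
      exact hξ.comp ξ ((hι.comp contDiff_fst).prodMk contDiff_snd).contDiffAt)
    (by simp only [hι0, hΔ0]) (by simp only [hι0, hN0])
    (by
      have h1 : HasFDerivAt m.disc (fderiv ℝ m.disc q) (planeFrame q i j 0) := by
        rw [hι0]
        exact (hΔ.self_of_nhds.differentiableAt (by simp)).hasFDerivAt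
      have h2 := h1.comp (0 : ℝ × ℝ) (hasFDerivAt_planeFrame q i j 0)
      have h3 : fderiv ℝ (fun z => m.disc (planeFrame q i j z)) 0 = _ := h2.fderiv
      rw [h3, ← hd]
      simp)
    hd0 (by simpa only [hι0] using hNd)
  have hzd : ∀ t, HasDerivAt (fun t => planeFrame q i j (t, y t))
      (EuclideanSpace.single i (1 : ℝ) + deriv y t • EuclideanSpace.single j (1 : ℝ)) t := by
    intro t
    have h1 := (hasFDerivAt_planeFrame q i j (t, y t)).comp_hasDerivAt t
      ((hasDerivAt_id t).prodMk ((hy.differentiable (by simp) t).hasDerivAt))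
    refine HasDerivAt.congr_deriv h1 ?_
    simp
  have hzi : ∀ t, deriv (fun t => planeFrame q i j (t, y t)) t i = 1 := fun t => by
    rw [(hzd t).deriv]
    simp [hij]
  have hzj : ∀ t, deriv (fun t => planeFrame q i j (t, y t)) t j = deriv y t := fun t => by
    rw [(hzd t).deriv]
    simp [hij.symm]
  refine ⟨fun t => planeFrame q i j (t, y t), hι.comp (contDiff_id.prodMk hy), ?_, hzi, ?_, ?_,
    hypos, ?_⟩
  · simp only [hy0]
    exact hι0
  · rw [hzj, hy0']
  · filter_upwards [hyode] with t ht
    rw [hlift _ t (hzd t).differentiableAt (by rw [hzi]; exact one_ne_zero)]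
    simp only [hzi, hzj, div_one, mul_one]
    exact ⟨ht.1, _, (((contDiff_infty_iff_deriv.1 hy).2.differentiable (by simp)) t).hasDerivAt,
      ht.2⟩
  · intro ζ ε hε hζ hζ0 hζi hζP hζl
    have hmem : Ioo (-ε) ε ∈ 𝓝 (0 : ℝ) := Ioo_mem_nhds (by linarith) hε
    have hζd : ∀ t ∈ Ioo (-ε) ε, HasDerivAt ζ (deriv ζ t) t := fun t ht =>
      ((hζ.contDiffAt (isOpen_Ioo.mem_nhds ht)).differentiableAt (by simp)).hasDerivAt
    have hcoord : ∀ k, ContDiffOn ℝ 1 (fun t => ζ t k - q k) (Ioo (-ε) ε) := fun k =>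
      ((EuclideanSpace.proj k : Plane →L[ℝ] ℝ).contDiff.comp_contDiffOn
        hζ).sub contDiffOn_const
    have hcd : ∀ k, ∀ t ∈ Ioo (-ε) ε, deriv (fun t => ζ t k - q k) t = deriv ζ t k :=
      fun k t ht => ((hasDerivAt_coord (hζd t ht) k).sub_const (q k)).deriv
    have hderc := hζ.continuousOn_deriv_of_isOpen isOpen_Ioo le_rfl
    have hne : ∀ᶠ t in 𝓝 (0 : ℝ), deriv ζ t i ≠ 0 :=
      ContinuousAt.eventually_ne (g := fun t => deriv ζ t i)
        ((EuclideanSpace.proj i : Plane →L[ℝ] ℝ).continuous.continuousAt.comp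
          (hderc.continuousAt hmem)) hζi
    have h0mem : (0 : ℝ) ∈ Ioo (-ε) ε := ⟨by linarith, hε⟩
    have key := eventually_mem_graph_of_ode
      (Δ := fun z => m.disc (planeFrame q i j z)) (N := fun ξ => N (planeFrame q i j ξ.1, ξ.2))
      hyuniq hε (hcoord i) (hcoord j) (by rw [hζ0, sub_self])
      (by rw [hζ0, sub_self]) (by rwa [hcd i 0 h0mem]) (by rwa [hcd i 0 h0mem, hcd j 0 h0mem]) ?_
    · filter_upwards [key] with t ht
      rw [← ht, planeFrame_sub hij]
    · rw [eventually_nhdsWithin_iff]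
      filter_upwards [hmem, hne] with t ht hti ht0
      obtain ⟨-, p', hp', heq⟩ := (hlift ζ t (hζd t ht).differentiableAt hti).1 (hζl t ht ht0)
      refine ⟨p', hp'.congr_of_eventuallyEq ?_, ?_⟩
      · filter_upwards [isOpen_Ioo.mem_nhds ht] with s hs
        rw [hcd i s hs, hcd j s hs]
      · rw [hcd i t ht, hcd j t ht, planeFrame_sub hij, heq]

/-! ### The lifted field in the two fibre coordinates. -/

namespace MetricCoeffs

theorem LiftTangentAt.congr {m : MetricCoeffs} {z w : ℝ → Plane} {t : ℝ}
    (h : m.LiftTangentAt z t) (hzw : z =ᶠ[𝓝 t] w) : m.LiftTangentAt w t := by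
  have hd := hzw.deriv
  refine ⟨fun h0 => ?_, fun h0 => ?_⟩
  · rw [← hd.eq_of_nhds] at h0
    obtain ⟨k, hk⟩ := h.1 h0
    refine ⟨k, ?_⟩
    rw [← hd.eq_of_nhds, ← hzw.eq_of_nhds]
    refine hk.congr_of_eventuallyEq ?_
    filter_upwards [hzw, hd] with s h1 h2
    rw [h1, h2]
  · rw [← hd.eq_of_nhds] at h0
    obtain ⟨k, hk⟩ := h.2 h0
    refine ⟨k, ?_⟩
    rw [← hd.eq_of_nhds, ← hzw.eq_of_nhds]
    refine hk.congr_of_eventuallyEq ?_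
    filter_upwards [hzw, hd] with s h1 h2
    rw [h1, h2]

/-- The component of the field along the fibre coordinate `r = dx/dy`. -/
noncomputable def inftyComponent (m : MetricCoeffs) (ξ : Plane × ℝ) : ℝ :=
  -(m.mu3 ξ.1 + m.mu2 ξ.1 * ξ.2 + m.mu1 ξ.1 * ξ.2 ^ 2 + m.mu0 ξ.1 * ξ.2 ^ 3)

theorem M_eq_inftyComponent (m : MetricCoeffs) (z : Plane) {p : ℝ} (hp : p ≠ 0) :
    m.M z p = -p ^ 3 * m.inftyComponent (z, p⁻¹) := by
  simp only [M, inftyComponent]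
  field_simp
  ring

/-- Proportionality of the lifted velocity and the field, in the fibre coordinate `p = dy/dx`. -/
theorem exists_hasDerivAt_field_iff {m : MetricCoeffs} {z : ℝ → Plane} {t : ℝ}
    (hz : DifferentiableAt ℝ z t) (h0 : deriv z t 0 ≠ 0) :
    (∃ k : ℝ, HasDerivAt (fun s => (z s, deriv z s 1 / deriv z s 0))
      (k • m.field (z t, deriv z t 1 / deriv z t 0)) t) ↔ m.disc (z t) ≠ 0 ∧
      ∃ p', HasDerivAt (fun s => deriv z s 1 / deriv z s 0) p' t ∧
        2 * m.disc (z t) * p' = m.M (z t) (deriv z t 1 / deriv z t 0) * deriv z t 0 := by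
  constructor
  · rintro ⟨k, hk⟩
    have h1 : HasDerivAt z _ t := hk.fst
    have h2 : HasDerivAt (fun s => deriv z s 1 / deriv z s 0) _ t := hk.snd
    -- The base component fixes `k`; regularity of the curve then forces `Δ ≠ 0`.
    have h3 : deriv z t 0 = k * (2 * m.disc (z t)) := by
      rw [h1.deriv]
      simp [field]
    refine ⟨fun h => h0 (by rw [h3, h]; simp), _, h2, ?_⟩
    change 2 * m.disc (z t) * (k * m.M (z t) (deriv z t 1 / deriv z t 0)) = _
    generalize m.M (z t) (deriv z t 1 / deriv z t 0) = c
    rw [h3]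
    ring
  · rintro ⟨hΔ, p', hp', heq⟩
    refine ⟨deriv z t 0 / (2 * m.disc (z t)), ?_⟩
    refine (hz.hasDerivAt.prodMk hp').congr_deriv (Prod.ext ?_ ?_)
    · refine Plane.ext_of_ne (zero_ne_one : (0 : Fin 2) ≠ 1) ?_ ?_
      · simp only [field, Prod.smul_mk, PiLp.smul_apply, smul_eq_mul, Matrix.cons_val_zero]
        field_simp
      · simp only [field, Prod.smul_mk, PiLp.smul_apply, smul_eq_mul, Matrix.cons_val_one]
        field_simp
        simpa using (mul_div_cancel₀ (deriv z t 1) h0).symm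
    · change p' = deriv z t 0 / (2 * m.disc (z t)) * m.M (z t) (deriv z t 1 / deriv z t 0)
      rw [div_mul_eq_mul_div, eq_div_iff (mul_ne_zero two_ne_zero hΔ), mul_comm p', heq, mul_comm]

/-- Proportionality of the lifted velocity and the field, in the fibre coordinate `r = dx/dy`. -/
theorem exists_hasDerivAt_fieldInfty_iff {m : MetricCoeffs} {z : ℝ → Plane} {t : ℝ}
    (hz : DifferentiableAt ℝ z t) (h0 : deriv z t 1 ≠ 0) :
    (∃ k : ℝ, HasDerivAt (fun s => (z s, deriv z s 0 / deriv z s 1))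
      (k • m.fieldInfty (z t, deriv z t 0 / deriv z t 1)) t) ↔ m.disc (z t) ≠ 0 ∧
      ∃ p', HasDerivAt (fun s => deriv z s 0 / deriv z s 1) p' t ∧
        2 * m.disc (z t) * p' =
          m.inftyComponent (z t, deriv z t 0 / deriv z t 1) * deriv z t 1 := by
  constructor
  · rintro ⟨k, hk⟩
    have h1 : HasDerivAt z _ t := hk.fst
    have h2 : HasDerivAt (fun s => deriv z s 0 / deriv z s 1) _ t := hk.snd
    have h3 : deriv z t 1 = k * (2 * m.disc (z t)) := by
      rw [h1.deriv]
      simp [fieldInfty]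
    refine ⟨fun h => h0 (by rw [h3, h]; simp), _, h2, ?_⟩
    change 2 * m.disc (z t) * (k * m.inftyComponent (z t, deriv z t 0 / deriv z t 1)) = _
    generalize m.inftyComponent (z t, deriv z t 0 / deriv z t 1) = c
    rw [h3]
    ring
  · rintro ⟨hΔ, p', hp', heq⟩
    refine ⟨deriv z t 1 / (2 * m.disc (z t)), ?_⟩
    refine (hz.hasDerivAt.prodMk hp').congr_deriv (Prod.ext ?_ ?_)
    · refine Plane.ext_of_ne (zero_ne_one : (0 : Fin 2) ≠ 1) ?_ ?_
      · simp only [fieldInfty, Prod.smul_mk, PiLp.smul_apply, smul_eq_mul, Matrix.cons_val_zero]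
        field_simp
      · simp only [fieldInfty, Prod.smul_mk, PiLp.smul_apply, smul_eq_mul, Matrix.cons_val_one]
        field_simp
        simp
    · change p' = deriv z t 1 / (2 * m.disc (z t)) *
        m.inftyComponent (z t, deriv z t 0 / deriv z t 1)
      rw [div_mul_eq_mul_div, eq_div_iff (mul_ne_zero two_ne_zero hΔ), mul_comm p', heq, mul_comm]

theorem liftTangentAt_iff {m : MetricCoeffs} {z : ℝ → Plane} {t : ℝ}
    (hz : DifferentiableAt ℝ z t) (h0 : deriv z t 0 ≠ 0) :
    m.LiftTangentAt z t ↔ m.disc (z t) ≠ 0 ∧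
      ∃ p', HasDerivAt (fun s => deriv z s 1 / deriv z s 0) p' t ∧
        2 * m.disc (z t) * p' = m.M (z t) (deriv z t 1 / deriv z t 0) * deriv z t 0 := by
  rw [← exists_hasDerivAt_field_iff hz h0]
  exact ⟨fun h => h.1 h0, fun h => ⟨fun _ => h, fun h' => absurd h' h0⟩⟩

/-- `LiftTangentAt` switches to `r = dx/dy` only at exactly vertical tangents, while nearby tangents
of a curve with vertical direction are tested with `p`. The substitution `r = 1/p` carries one
equation to the other, so a single equation in `r` covers a whole neighbourhood. -/
theorem liftTangentAt_iff_infty {m : MetricCoeffs} {z : ℝ → Plane} {t : ℝ}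
    (hz : DifferentiableAt ℝ z t) (h1 : deriv z t 1 ≠ 0) :
    m.LiftTangentAt z t ↔ m.disc (z t) ≠ 0 ∧
      ∃ p', HasDerivAt (fun s => deriv z s 0 / deriv z s 1) p' t ∧
        2 * m.disc (z t) * p' =
          m.inftyComponent (z t, deriv z t 0 / deriv z t 1) * deriv z t 1 := by
  by_cases h0 : deriv z t 0 = 0
  · rw [← exists_hasDerivAt_fieldInfty_iff hz h1]
    exact ⟨fun h => h.2 h0, fun h => ⟨fun h' => absurd h0 h', fun _ => h⟩⟩
  · rw [liftTangentAt_iff hz h0]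
    have hp0 : deriv z t 1 / deriv z t 0 ≠ 0 := div_ne_zero h1 h0
    have hr0 : deriv z t 0 / deriv z t 1 ≠ 0 := div_ne_zero h0 h1
    rw [M_eq_inftyComponent m _ hp0, inv_div]
    generalize m.inftyComponent (z t, deriv z t 0 / deriv z t 1) = c
    refine and_congr_right fun hΔ => ⟨?_, ?_⟩
    · rintro ⟨p', hp', heq⟩
      have h2 := hp'.fun_inv hp0
      simp only [inv_div] at h2
      refine ⟨_, h2, ?_⟩
      rw [mul_div_assoc', mul_neg, heq]
      field_simp
    · rintro ⟨p', hp', heq⟩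
      have h2 := hp'.fun_inv hr0
      simp only [inv_div] at h2
      refine ⟨_, h2, ?_⟩
      rw [mul_div_assoc', mul_neg, heq]
      field_simp

/-! ### The trace identity. -/

theorem fderiv_disc {m : MetricCoeffs} {q : Plane} (ha : DifferentiableAt ℝ m.a q)
    (hb : DifferentiableAt ℝ m.b q) (hc : DifferentiableAt ℝ m.c q) (v : Plane) :
    fderiv ℝ m.disc q v = fderiv ℝ m.a q v * m.c q + m.a q * fderiv ℝ m.c q v
      - 2 * m.b q * fderiv ℝ m.b q v := by
  have h : HasFDerivAt m.disc _ q :=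
    (ha.hasFDerivAt.mul hc.hasFDerivAt).sub (hb.hasFDerivAt.pow 2)
  rw [h.fderiv]
  simp
  ring

/-- The trace of the field at a non-isotropic singular point vanishes, up to the factor
`a + 2 b p + c p²`. -/
theorem saddle_trace {m : MetricCoeffs} {q : Plane} (ha : DifferentiableAt ℝ m.a q)
    (hb : DifferentiableAt ℝ m.b q) (hc : DifferentiableAt ℝ m.c q) {P : ℝ}
    (hΔ : m.disc q = 0) (hM : m.M q P = 0)
    (hiso : m.a q + 2 * m.b q * P + m.c q * P ^ 2 ≠ 0) :
    m.mu1 q + 2 * m.mu2 q * P + 3 * m.mu3 q * P ^ 2 =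
      -2 * fderiv ℝ m.disc q
        (EuclideanSpace.single 0 (1 : ℝ) + P • EuclideanSpace.single 1 (1 : ℝ)) := by
  rw [fderiv_disc ha hb hc]
  simp only [map_add, map_smul, smul_eq_mul]
  refine mul_left_cancel₀ hiso ?_
  simp only [disc, M, mu0, mu1, mu2, mu3, partialX, partialY] at hΔ hM ⊢
  generalize fderiv ℝ m.a q (EuclideanSpace.single 0 1) = ax at *
  generalize fderiv ℝ m.a q (EuclideanSpace.single 1 1) = ay at *
  generalize fderiv ℝ m.b q (EuclideanSpace.single 0 1) = bx at *
  generalize fderiv ℝ m.b q (EuclideanSpace.single 1 1) = bY at *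
  generalize fderiv ℝ m.c q (EuclideanSpace.single 0 1) = cx at *
  generalize fderiv ℝ m.c q (EuclideanSpace.single 1 1) = cy at *
  -- With `F = a + 2bp + cp²`, this is the identity `F (M_p + 2(Δ_x + pΔ_y)) = (3/2) F_p M + 3 (F_x
  -- + pF_y) Δ`.
  linear_combination 3 * (m.b q + m.c q * P) * hM +
    (3 * cy * P ^ 3 + (6 * bY + 3 * cx) * P ^ 2 + (3 * ay + 6 * bx) * P + 3 * ax) * hΔ

/-- The counterpart at `r = 0` rests on `c (μ₂ - 2Δ_y) = 3bμ₃ - 3c_yΔ`. Since the fibre component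
there starts with `-(μ₃ + μ₂ r)`, its derivative is `-μ₂ = -2Δ_y`, again the opposite of the base
eigenvalue. -/
theorem saddle_trace_infty {m : MetricCoeffs} {q : Plane} (ha : DifferentiableAt ℝ m.a q)
    (hb : DifferentiableAt ℝ m.b q) (hc : DifferentiableAt ℝ m.c q)
    (hΔ : m.disc q = 0) (hM : m.mu3 q = 0) (hiso : m.c q ≠ 0) :
    m.mu2 q = 2 * fderiv ℝ m.disc q
      (EuclideanSpace.single 1 (1 : ℝ) + (0 : ℝ) • EuclideanSpace.single 0 (1 : ℝ)) := by
  rw [zero_smul, add_zero, fderiv_disc ha hb hc]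
  refine mul_left_cancel₀ hiso ?_
  simp only [disc, mu2, mu3, partialX, partialY] at hΔ hM ⊢
  generalize fderiv ℝ m.a q (EuclideanSpace.single 1 1) = ay at *
  generalize fderiv ℝ m.b q (EuclideanSpace.single 1 1) = bY at *
  generalize fderiv ℝ m.c q (EuclideanSpace.single 0 1) = cx at *
  generalize fderiv ℝ m.c q (EuclideanSpace.single 1 1) = cy at *
  linear_combination 3 * m.b q * hM - 3 * cy * hΔ

section Smoothness

variable {m : MetricCoeffs}

theorem contDiffAt_partial {f : Plane → ℝ} {z : Plane} (hf : ContDiffAt ℝ ∞ f z) :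
    ContDiffAt ℝ ∞ (partialX f) z ∧ ContDiffAt ℝ ∞ (partialY f) z :=
  have h : ContDiffAt ℝ ∞ (fderiv ℝ f) z := hf.fderiv_right (by simp)
  ⟨h.clm_apply contDiffAt_const, h.clm_apply contDiffAt_const⟩

theorem contDiffAt_disc {z : Plane} (ha : ContDiffAt ℝ ∞ m.a z) (hb : ContDiffAt ℝ ∞ m.b z)
    (hc : ContDiffAt ℝ ∞ m.c z) : ContDiffAt ℝ ∞ m.disc z :=
  (ha.mul hc).sub (hb.pow 2)

theorem contDiffAt_mu {z : Plane} (ha : ContDiffAt ℝ ∞ m.a z) (hb : ContDiffAt ℝ ∞ m.b z)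
    (hc : ContDiffAt ℝ ∞ m.c z) : ContDiffAt ℝ ∞ m.mu0 z ∧ ContDiffAt ℝ ∞ m.mu1 z ∧
      ContDiffAt ℝ ∞ m.mu2 z ∧ ContDiffAt ℝ ∞ m.mu3 z := by
  obtain ⟨hax, hay⟩ := contDiffAt_partial ha
  obtain ⟨hbx, hby⟩ := contDiffAt_partial hb
  obtain ⟨hcx, hcy⟩ := contDiffAt_partial hc
  unfold mu0 mu1 mu2 mu3
  refine ⟨?_, ?_, ?_, ?_⟩ <;> fun_prop

theorem contDiffAt_M {ξ : Plane × ℝ} (ha : ContDiffAt ℝ ∞ m.a ξ.1) (hb : ContDiffAt ℝ ∞ m.b ξ.1)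
    (hc : ContDiffAt ℝ ∞ m.c ξ.1) :
    ContDiffAt ℝ ∞ (fun ξ : Plane × ℝ => m.M ξ.1 ξ.2) ξ ∧ ContDiffAt ℝ ∞ m.inftyComponent ξ := by
  obtain ⟨h0, h1, h2, h3⟩ := contDiffAt_mu ha hb hc
  have e0 := h0.comp ξ contDiffAt_fst
  have e1 := h1.comp ξ contDiffAt_fst
  have e2 := h2.comp ξ contDiffAt_fst
  have e3 := h3.comp ξ contDiffAt_fst
  have s := contDiffAt_snd (𝕜 := ℝ) (n := ∞) (p := ξ)
  exact ⟨((e0.add (e1.mul s)).add (e2.mul (s.pow 2))).add (e3.mul (s.pow 3)),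
    (((e3.add (e2.mul s)).add (e1.mul (s.pow 2))).add (e0.mul (s.pow 3))).neg⟩

end Smoothness

end MetricCoeffs

/-! ### Directions, timelikeness and geodesic germs on the surface. -/

theorem direction_eq_coe_iff {v : Plane} {P : ℝ} :
    direction v = (P : OnePoint ℝ) ↔ v 0 ≠ 0 ∧ v 1 / v 0 = P := by
  unfold direction
  split_ifs with h
  · simp [h]
  · simp [h]

theorem direction_eq_infty_iff {v : Plane} (hv : v ≠ 0) :
    direction v = OnePoint.infty ↔ v 1 ≠ 0 ∧ v 0 / v 1 = 0 := by
  unfold direction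
  split_ifs with h
  · have : v 1 ≠ 0 := fun h1 => hv (Plane.ext_of_ne (zero_ne_one : (0 : Fin 2) ≠ 1) h h1)
    simp [h, this]
  · simp only [OnePoint.coe_ne_infty, false_iff, not_and, div_eq_zero_iff, h, false_or]
    exact fun h1 h2 => h1 h2

namespace SurfaceMetric

variable {S : Type*} [TopologicalSpace S] [ChartedSpace Plane S] [IsManifold 𝓘(ℝ, Plane) ∞ S]

/-- An integral curve in the chart, unique among those with the given direction, defines a unique
timelike geodesic germ on the surface. -/
theorem exists_geodesic_of_integral_curve (g : SurfaceMetric S) {q : S}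
    {φ : OpenPartialHomeomorph S Plane} (hq : q ∈ φ.source)
    (hsign : ∀ᶠ z in 𝓝 (φ q), 0 < (g.coeffs φ).disc z →
      ∀ v : Plane, v ≠ 0 → 0 < (g.coeffs φ).quad z v)
    (ha : ContinuousAt (g.coeffs φ).a (φ q)) (hb : ContinuousAt (g.coeffs φ).b (φ q))
    (hc : ContinuousAt (g.coeffs φ).c (φ q)) {i j : Fin 2} {P : ℝ} {p : OnePoint ℝ}
    (hdir : ∀ v : Plane, v ≠ 0 → (direction v = p ↔ v i ≠ 0 ∧ v j / v i = P))
    (hiso : ∀ v : Plane, v i = 1 → v j = P → (g.coeffs φ).quad (φ q) v ≠ 0)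
    (hcurve : ∃ z : ℝ → Plane, ContDiff ℝ ∞ z ∧ z 0 = φ q ∧ (∀ t, deriv z t i = 1) ∧
      deriv z 0 j = P ∧ (∀ᶠ t in 𝓝[≠] 0, (g.coeffs φ).LiftTangentAt z t) ∧
      (∃ᶠ t in 𝓝 0, 0 < (g.coeffs φ).disc (z t)) ∧
      ∀ (ζ : ℝ → Plane) (ε : ℝ), 0 < ε → ContDiffOn ℝ 1 ζ (Ioo (-ε) ε) → ζ 0 = φ q →
        deriv ζ 0 i ≠ 0 → deriv ζ 0 j / deriv ζ 0 i = P →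
        (∀ t ∈ Ioo (-ε) ε, t ≠ 0 → (g.coeffs φ).LiftTangentAt ζ t) →
        ∀ᶠ t in 𝓝 0, ζ t = z (ζ t i - φ q i)) :
    ∃ (ε : ℝ) (γ : ℝ → S),
      g.IsGeodesicThrough φ q p ε γ ∧
      ContDiffOn ℝ ∞ (φ ∘ γ) (Ioo (-ε) ε) ∧
      g.IsTimelike φ ε γ ∧
      ∀ (ε' : ℝ) (γ' : ℝ → S), g.IsGeodesicThrough φ q p ε' γ' →
        IsLocalReparametrization ε γ ε' γ' := by
  obtain ⟨z, hz, hz0, hzi, hzj, hlift, hpos, huniq⟩ := hcurve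
  have hzc : Tendsto z (𝓝 0) (𝓝 (φ q)) := hz0 ▸ hz.continuous.tendsto 0
  have hne : ∀ t, deriv z t ≠ 0 := fun t h => by
    have := hzi t
    rw [h] at this
    simp at this
  have hz'c : Continuous (deriv z) := hz.continuous_deriv (by simp)
  have hquad : ContinuousAt (fun t => (g.coeffs φ).quad (z t) (deriv z t)) 0 := by
    have h1 : ∀ k : Fin 2, ContinuousAt (fun t => deriv z t k) 0 := fun k =>
      ((EuclideanSpace.proj k : Plane →L[ℝ] ℝ).continuous.comp hz'c).continuousAt
    have ha' : ContinuousAt (fun t => (g.coeffs φ).a (z t)) 0 :=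
      ContinuousAt.comp (by rwa [hz0]) hz.continuous.continuousAt
    have hb' : ContinuousAt (fun t => (g.coeffs φ).b (z t)) 0 :=
      ContinuousAt.comp (by rwa [hz0]) hz.continuous.continuousAt
    have hc' : ContinuousAt (fun t => (g.coeffs φ).c (z t)) 0 :=
      ContinuousAt.comp (by rwa [hz0]) hz.continuous.continuousAt
    exact ((ha'.mul ((h1 0).pow 2)).add (((continuousAt_const.mul hb').mul (h1 0)).mul (h1 1))).add
      (hc'.mul ((h1 1).pow 2))
  have hquad0 : 0 < (g.coeffs φ).quad (z 0) (deriv z 0) := by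
    have h1 : (g.coeffs φ).quad (z 0) (deriv z 0) ≠ 0 := by
      rw [hz0]
      exact hiso _ (hzi 0) hzj
    -- A negative value at `0` would persist nearby, contradicting positive definiteness at the
    -- points with `Δ > 0` that accumulate at `0`.
    refine lt_of_le_of_ne (not_lt.1 fun hlt => ?_) h1.symm
    obtain ⟨t, ht, ht', ht''⟩ := (hpos.and_eventually
      ((hzc.eventually hsign).and (hquad.eventually (gt_mem_nhds hlt)))).exists
    exact lt_asymm ht'' (ht' ht _ (hne t))
  obtain ⟨ε, hε, H⟩ := Metric.eventually_nhds_iff_ball.1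
    ((hzc.eventually (φ.open_target.mem_nhds (φ.map_source hq))).and
      ((eventually_nhdsWithin_iff.1 hlift).and (hquad.eventually (lt_mem_nhds hquad0))))
  have H' : ∀ t ∈ Ioo (-ε) ε, z t ∈ φ.target ∧ (t ≠ 0 → (g.coeffs φ).LiftTangentAt z t) ∧
      0 < (g.coeffs φ).quad (z t) (deriv z t) := fun t ht =>
    H t (by rwa [Real.ball_eq_Ioo, zero_sub, zero_add])
  have heq : ∀ t ∈ Ioo (-ε) ε, (φ ∘ (φ.symm ∘ z)) t = z t := fun t ht =>
    φ.right_inv (H' t ht).1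
  have heq' : ∀ t ∈ Ioo (-ε) ε, (φ ∘ (φ.symm ∘ z)) =ᶠ[𝓝 t] z := fun t ht => by
    filter_upwards [isOpen_Ioo.mem_nhds ht] with s hs using heq s hs
  have h0 : (0 : ℝ) ∈ Ioo (-ε) ε := ⟨by linarith, hε⟩
  refine ⟨ε, φ.symm ∘ z, ⟨hε, fun t ht => φ.map_target (H' t ht).1,
    (hz.of_le (by simp)).contDiffOn.congr heq, fun t ht => ?_, ?_, ?_, fun t ht ht0 => ?_⟩,
    hz.contDiffOn.congr heq, fun t ht => ?_, ?_⟩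
  · rw [(heq' t ht).deriv_eq]
    exact hne t
  · rw [Function.comp_apply, hz0, φ.left_inv hq]
  · rw [(heq' 0 h0).deriv_eq, hdir _ (hne 0), hzi, hzj]
    simp
  · exact ((H' t ht).2.1 ht0).congr (heq' t ht).symm
  · rw [(heq' t ht).deriv_eq]
    have := (H' t ht).2.2
    rwa [← heq t ht] at this
  · intro ε' γ' hγ'
    have hmem : Ioo (-ε') ε' ∈ 𝓝 (0 : ℝ) := Ioo_mem_nhds (by linarith [hγ'.pos]) hγ'.pos
    have h0' : (0 : ℝ) ∈ Ioo (-ε') ε' := mem_of_mem_nhds hmem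
    have hζ0 : (φ ∘ γ') 0 = φ q := by rw [Function.comp_apply, hγ'.map_zero]
    obtain ⟨hd1, hd2⟩ := (hdir _ (hγ'.regular 0 h0')).1 hγ'.direction_zero
    have hu := huniq (φ ∘ γ') ε' hγ'.pos hγ'.contDiffOn hζ0 hd1 hd2 hγ'.integral
    -- The parameter of `z` is its `i`-th coordinate measured from `φ q`, so the same coordinate
    -- along the competing curve is the change of parameter.
    have hθ : ContDiffOn ℝ 1 (fun t => (φ ∘ γ') t i - φ q i) (Ioo (-ε') ε') :=
      ((EuclideanSpace.proj i : Plane →L[ℝ] ℝ).contDiff.comp_contDiffOn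
        hγ'.contDiffOn).sub contDiffOn_const
    have hθ0 : (φ ∘ γ') 0 i - φ q i = 0 := by rw [hζ0, sub_self]
    have hθ' : ∀ t ∈ Ioo (-ε') ε', deriv (fun t => (φ ∘ γ') t i - φ q i) t =
        deriv (φ ∘ γ') t i := fun t ht =>
      ((hasDerivAt_coord ((hγ'.contDiffOn.contDiffAt
        (isOpen_Ioo.mem_nhds ht)).differentiableAt (by simp)).hasDerivAt i).sub_const _).deriv
    have hdne : ∀ᶠ t in 𝓝 (0 : ℝ), deriv (fun t => (φ ∘ γ') t i - φ q i) t ≠ 0 :=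
      ((hθ.continuousOn_deriv_of_isOpen isOpen_Ioo le_rfl).continuousAt hmem).eventually_ne
        (by rwa [hθ' 0 h0'])
    have hθmem : ∀ᶠ t in 𝓝 (0 : ℝ), (φ ∘ γ') t i - φ q i ∈ Ioo (-ε) ε := by
      have h1 := (hθ.continuousOn.continuousAt hmem).eventually
        (isOpen_Ioo.mem_nhds (by rwa [hθ0] : (φ ∘ γ') 0 i - φ q i ∈ Ioo (-ε) ε))
      exact h1
    obtain ⟨δ, hδ, Hδ⟩ := Metric.eventually_nhds_iff_ball.1 (hu.and (hdne.and hθmem))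
    refine ⟨min δ ε', lt_min hδ hγ'.pos, min_le_right _ _, fun t => (φ ∘ γ') t i - φ q i, hθ0,
      hθ.mono (Ioo_subset_Ioo (neg_le_neg (min_le_right _ _)) (min_le_right _ _)),
      fun t ht => ?_⟩
    have ht1 : t ∈ Metric.ball (0 : ℝ) δ := by
      rw [Real.ball_eq_Ioo, zero_sub, zero_add]
      exact Ioo_subset_Ioo (neg_le_neg (min_le_left _ _)) (min_le_left _ _) ht
    have ht2 : t ∈ Ioo (-ε') ε' :=
      Ioo_subset_Ioo (neg_le_neg (min_le_right _ _)) (min_le_right _ _) ht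
    obtain ⟨h1, h2, h3⟩ := Hδ t ht1
    refine ⟨h2, h3, ?_⟩
    rw [Function.comp_apply, ← h1, Function.comp_apply, φ.left_inv (hγ'.mem_source t ht2)]

end SurfaceMetric

theorem theorem2 {S : Type*} [TopologicalSpace S] [ChartedSpace Plane S]
    [IsManifold 𝓘(ℝ, Plane) ∞ S] (g : SurfaceMetric S)
    (q : S) (φ : OpenPartialHomeomorph S Plane)
    (hφ : φ ∈ IsManifold.maximalAtlas 𝓘(ℝ, Plane) ∞ S) (hq : q ∈ φ.source)
    (hsign : ∀ᶠ z in 𝓝 (φ q), 0 < (g.coeffs φ).disc z →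
      ∀ v : Plane, v ≠ 0 → 0 < (g.coeffs φ).quad z v)
    (p₀ p₁ p₂ : OnePoint ℝ) (hC3 : (g.coeffs φ).CaseC3 (φ q) p₀ p₁ p₂) :
    ∀ p : OnePoint ℝ, p = p₁ ∨ p = p₂ →
      ∃ (ε : ℝ) (γ : ℝ → S),
        g.IsGeodesicThrough φ q p ε γ ∧
        ContDiffOn ℝ ∞ (φ ∘ γ) (Ioo (-ε) ε) ∧
        g.IsTimelike φ ε γ ∧
        ∀ (ε' : ℝ) (γ' : ℝ → S), g.IsGeodesicThrough φ q p ε' γ' →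
          IsLocalReparametrization ε γ ε' γ' := by
  intro p hp
  have hroot : (g.coeffs φ).IsSimpleRoot (φ q) p := by
    rcases hp with rfl | rfl
    exacts [hC3.root1, hC3.root2]
  have hiso : ¬ (g.coeffs φ).IsIsotropic (φ q) p := by
    rcases hp with rfl | rfl
    exacts [hC3.nonisotropic1, hC3.nonisotropic2]
  have hΔ0 := hC3.degenerate
  have hsmooth : ∀ u v : Plane, ∀ z ∈ φ.target, ContDiffAt ℝ ∞ (g.inChart φ u v) z :=
    fun u v z hz => (g.smooth φ hφ u v).contDiffAt (φ.open_target.mem_nhds hz)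
  have ha : ∀ z ∈ φ.target, ContDiffAt ℝ ∞ (g.coeffs φ).a z := hsmooth _ _
  have hb : ∀ z ∈ φ.target, ContDiffAt ℝ ∞ (g.coeffs φ).b z := hsmooth _ _
  have hc : ∀ z ∈ φ.target, ContDiffAt ℝ ∞ (g.coeffs φ).c z := hsmooth _ _
  have hqt : φ q ∈ φ.target := φ.map_source hq
  have htarget : ∀ᶠ z in 𝓝 (φ q), z ∈ φ.target := φ.open_target.mem_nhds hqt
  have haq := (ha _ hqt).differentiableAt (by simp)
  have hbq := (hb _ hqt).differentiableAt (by simp)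
  have hcq := (hc _ hqt).differentiableAt (by simp)
  have hdisc : ∀ᶠ z in 𝓝 (φ q), ContDiffAt ℝ ∞ (g.coeffs φ).disc z := by
    filter_upwards [htarget] with z hz
    exact MetricCoeffs.contDiffAt_disc (ha z hz) (hb z hz) (hc z hz)
  have hfst : ∀ P : ℝ, ∀ᶠ ξ in 𝓝 (φ q, P), ξ.1 ∈ φ.target := fun P =>
    (continuous_fst.tendsto (φ q, P)).eventually htarget
  generalize hm : g.coeffs φ = m at *
  induction p using OnePoint.rec with
  | infty =>
    obtain ⟨hμ3, hμ2⟩ : m.mu3 (φ q) = 0 ∧ m.mu2 (φ q) ≠ 0 := hroot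
    have hciso : m.c (φ q) ≠ 0 := hiso
    have htrace := MetricCoeffs.saddle_trace_infty haq hbq hcq hΔ0 hμ3 hciso
    subst hm
    -- At `p = ∞` the coordinate `y` is the parameter and the slope is `r = dx/dy = 0`. Simplicity
    -- of the root enters only through the trace identity, to give `d ≠ 0`.
    refine g.exists_geodesic_of_integral_curve hq hsign haq.continuousAt hbq.continuousAt
      hcq.continuousAt (i := 1) (j := 0) (P := 0) (fun v hv => direction_eq_infty_iff hv)
      (fun v h1 h0 => by simpa [MetricCoeffs.quad, h1, h0] using hciso)
      (MetricCoeffs.exists_integral_curve one_ne_zero hdisc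
        (N := (g.coeffs φ).inftyComponent) ?_ hΔ0 (by simp [MetricCoeffs.inftyComponent, hμ3]) rfl
        (fun h => hμ2 (by rw [htrace, h, mul_zero])) ?_
        (fun z t hz h => MetricCoeffs.liftTangentAt_iff_infty hz h))
    · filter_upwards [hfst 0] with ξ hξ
      exact (MetricCoeffs.contDiffAt_M (ha _ hξ) (hb _ hξ) (hc _ hξ)).2
    · have h1 := ((((hasDerivAt_const (0 : ℝ) ((g.coeffs φ).mu3 (φ q))).add
        ((hasDerivAt_id (0 : ℝ)).const_mul ((g.coeffs φ).mu2 (φ q)))).add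
        (((hasDerivAt_id (0 : ℝ)).pow 2).const_mul ((g.coeffs φ).mu1 (φ q)))).add
        (((hasDerivAt_id (0 : ℝ)).pow 3).const_mul ((g.coeffs φ).mu0 (φ q)))).neg
      refine HasDerivAt.congr_deriv (f := fun p => (g.coeffs φ).inftyComponent (φ q, p)) h1 ?_
      simp [htrace]
  | coe P =>
    obtain ⟨hM, hM'⟩ : m.M (φ q) P = 0 ∧
      m.mu1 (φ q) + 2 * m.mu2 (φ q) * P + 3 * m.mu3 (φ q) * P ^ 2 ≠ 0 := hroot
    have hPiso : m.a (φ q) + 2 * m.b (φ q) * P + m.c (φ q) * P ^ 2 ≠ 0 := hiso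
    have htrace := MetricCoeffs.saddle_trace haq hbq hcq hΔ0 hM hPiso
    subst hm
    refine g.exists_geodesic_of_integral_curve hq hsign haq.continuousAt hbq.continuousAt
      hcq.continuousAt (i := 0) (j := 1) (P := P) (fun v hv => direction_eq_coe_iff)
      (fun v h0 h1 => by simpa [MetricCoeffs.quad, h1, h0] using hPiso)
      (MetricCoeffs.exists_integral_curve zero_ne_one hdisc
        (N := fun ξ => (g.coeffs φ).M ξ.1 ξ.2) ?_ hΔ0 hM rfl
        (fun h => hM' (by rw [htrace, h, mul_zero])) ?_
        (fun z t hz h => MetricCoeffs.liftTangentAt_iff hz h))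
    · filter_upwards [hfst P] with ξ hξ
      exact (MetricCoeffs.contDiffAt_M (ha _ hξ) (hb _ hξ) (hc _ hξ)).1
    · have h1 := (((hasDerivAt_const P ((g.coeffs φ).mu0 (φ q))).add
        ((hasDerivAt_id P).const_mul ((g.coeffs φ).mu1 (φ q)))).add
        (((hasDerivAt_id P).pow 2).const_mul ((g.coeffs φ).mu2 (φ q)))).add
        (((hasDerivAt_id P).pow 3).const_mul ((g.coeffs φ).mu3 (φ q)))
      refine HasDerivAt.congr_deriv (f := fun p => (g.coeffs φ).M (φ q) p) h1 ?_
      rw [← htrace]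
      simp
      ring
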